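/- **Model.** Let $0<R_{\sf E}<R_{\sf S}$ and let $\mathcal S_R\subset\mathbb R^3$ be the sphere of radius $R$ centred at the origin. Satellites, users and eavesdroppers form independent homogeneous Poisson point processes $\Phi$ on $\mathcal S_{R_{\sf S}}$ and $\Phi_{\sf u},\Phi_{\sf e}$ on $\mathcal S_{R_{\sf E}}$, with densities $\lambda,\lambda_{\sf u},\lambda_{\sf e}>0$. The typical user is fixed at $\mathbf u_1=(0,0,R_{\sf E})$ (Slivnyak's theorem; $\Phi_{\sf u}$ consists of the other users). Let $0\le h_{\sf s}<R_{\sf S}-R_{\sf E}$ and $R_{\sf E}^2/R_{\sf S}\le h_{\sf e}<R_{\sf E}$. The visible cap is $\mathcal A=\{y\in\mathcal S_{R_{\sf S}}: y_3\ge R_{\sf E}+h_{\sf s}\}$. The serving satellite $\mathbf x_1$ is the satellite nearest to $\mathbf u_1$; the user is served iff $\Phi(\mathcal A)\ge1$. The eavesdropper cap is $\mathcal A_{\sf e}=\{y\in\mathcal S_{R_{\sf E}}:\langle y,\mathbf x_1\rangle\ge h_{\sf e}\|\mathbf x_1\|\}$, and $\mathbf e_1$ is the eavesdropper nearest to $\mathbf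 x_1$. Put $d_1=\|\mathbf x_1-\mathbf u_1\|$ and $d_e=\|\mathbf x_1-\mathbf e_1\|$. The fading powers from the satellites to the typical user and from the serving satellite to the eavesdroppers are independent of the point processes, the two families are independent of each other, and the square root $\sqrt H$ of each has the Shadowed-Rician density $$\Big(\tfrac{2bm}{2bm+\Omega}\Big)^m\frac xb\,e^{-x^2/(2b)}\,{}_1F_1\Big(m;1;\tfrac{\Omega x^2}{2b(2bm+\Omega)}\Big),\qquad x>0,$$ with $m\ge1$ an integer, $b>0$, $\Omega\ge0$. $H_1^{\sf u}$ and $H_1^{\sf e}$ are the fading powers of the links $\mathbf x_1\to\mathbf u_1$ and $\mathbf x_1\to\mathbf e_1$. With $P,\sigma^2>0$, path-loss exponent $\alpha\in\mathbb R$, positive antenna gains, speed of light $c_0>0$ and carrier frequency $f_c>0$, let $G=G_{\sf tx}^{\sf main}G_{\sf rx}^{\sf main}\frac{c_0^2}{(4\pi f_c)^2}$, $\hat G=G_{\sf tx}^{\sf side}G_{\sf rx}^{\sf main}\frac{c_0^2}{(4\pi f_c)^2}$ and $G_{\sf e}\in\{G,\hat G\}$. Let $$D=\log_2\Big(1+\tfrac{GPH_1^{\sf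 u}d_1^{-\alpha}}{\sigma^2}\Big)-\log_2\Big(1+\tfrac{G_{\sf e}PH_1^{\sf e}d_e^{-\alpha}}{\sigma^2}\Big),$$ where the second term is $0$ if $\Phi_{\sf e}(\mathcal A_{\sf e})=0$. The ergodic secrecy rate is $R^{\sf sec}=\mathbb E[\max\{D,0\}\mathbf 1_{\Phi(\mathcal A)\ge1}]$, and $F^c(\gamma)=\mathbb P[\Phi(\mathcal A)\ge1,\ D\ge\gamma]$ for $\gamma\ge 0$. **Notation.** $\tilde\lambda=\lambda R_{\sf S}/R_{\sf E}$, $\tilde\lambda_{\sf e}=\lambda_{\sf e}R_{\sf E}/R_{\sf S}$, $R_{\sf min}=R_{\sf S}-R_{\sf E}$, $R_{\sf max}^{\sf u}=\sqrt{R_{\sf S}^2-R_{\sf E}^2-2R_{\sf E}h_{\sf s}}$, $R_{\sf max}^{\sf e}=\sqrt{R_{\sf S}^2+R_{\sf E}^2-2R_{\sf S}h_{\sf e}}$, $q=e^{-\tilde\lambda\pi((R_{\sf max}^{\sf u})^2-R_{\sf min}^2)}$, $q_{\sf e}=e^{-\tilde\lambda_{\sf e}\pi((R_{\sf max}^{\sf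 e})^2-R_{\sf min}^2)}$, $\bar\sigma^2=\frac{\sigma^2}{PG}$, $\bar G=\frac{G_{\sf e}}G$, $\beta=\frac1{2b}$, $c=\frac{\Omega}{2b(2bm+\Omega)}$, $\zeta(z)=\big(\frac{2bm}{2bm+\Omega}\big)^m\frac{\beta(-1)^z(1-m)_zc^z}{(z!)^2}$ with the rising Pochhammer symbol $(x)_z$, $$f_{d_1}(r)=\frac{2\tilde\lambda\pi e^{\tilde\lambda\pi R_{\sf min}^2}}{1-q}\,re^{-\tilde\lambda\pi r^2},\qquad f_{d_e}(r)=\frac{2\tilde\lambda_{\sf e}\pi e^{\tilde\lambda_{\sf e}\pi R_{\sf min}^2}}{1-q_{\sf e}}\,re^{-\tilde\lambda_{\sf e}\pi r^2},$$ $$\mathcal L_{\gamma,r}(s)=e^{-s(2^\gamma\bar\sigma^2-\bar\sigma^2)}\sum_{z=0}^{m-1}\zeta(z)\frac{\Gamma(z+1)}{(\beta-c+s2^\gamma\bar Gr^{-\alpha})^{z+1}}.$$ **Theorem 1.** 1. $\mathbb P[\Phi(\mathcal A)\ge1,\Phi_{\sf e}(\mathcal A_{\sf e})=0]=(1-q)q_{\sf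 e}$ and $\mathbb P[\Phi(\mathcal A)\ge1,\Phi_{\sf e}(\mathcal A_{\sf e})\ge1]=(1-q)(1-q_{\sf e})$. 2. Given $\Phi(\mathcal A)\ge1$, $d_1$ has density $f_{d_1}$ on $[R_{\sf min},R_{\sf max}^{\sf u}]$; given $\Phi(\mathcal A)\ge1$ and $\Phi_{\sf e}(\mathcal A_{\sf e})\ge1$, $d_e$ has density $f_{d_e}$ on $[R_{\sf min},R_{\sf max}^{\sf e}]$. 3. For $\gamma\ge0$, $r>0$, $s\ge0$, given $\Phi(\mathcal A)\ge1$ and $\Phi_{\sf e}(\mathcal A_{\sf e})\ge1$, the Laplace transform at $s$ of $2^\gamma(\bar\sigma^2+\bar GH_1^{\sf e}r^{-\alpha})-\bar\sigma^2$ is $\mathcal L_{\gamma,r}(s)$. 4. For $\gamma\ge0$, $F^c(\gamma)=(1-q)q_{\sf e}F_0(\gamma)+(1-q)(1-q_{\sf e})F_1(\gamma)$, where $F_0(\gamma)$ and $F_1(\gamma)$ are the conditional probabilities of $D\ge\gamma$ given the first, respectively the second, event of part 1, and $$F_0(\gamma)=\int_{R_{\sf min}}^{R_{\sf max}^{\sf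 u}}\Big[1-\sum_{z=0}^{m-1}\frac{\zeta(z)\Gamma(z+1)}{(\beta-c)^{z+1}}\Big(1-e^{-(\beta-c)(2^\gamma-1)\bar\sigma^2r_1^\alpha}\sum_{v=0}^z\frac{(\beta-c)^v((2^\gamma-1)\bar\sigma^2r_1^\alpha)^v}{v!}\Big)\Big]f_{d_1}(r_1)\,dr_1,$$ $$F_1(\gamma)=\int_{R_{\sf min}}^{R_{\sf max}^{\sf e}}\int_{R_{\sf min}}^{R_{\sf max}^{\sf u}}\Big[1-\sum_{z=0}^{m-1}\frac{\zeta(z)\Gamma(z+1)}{(\beta-c)^{z+1}}\Big(1-\sum_{v=0}^z\frac{(\beta-c)^v(r_1^\alpha)^v}{v!}(-1)^v\frac{d^v\mathcal L_{\gamma,r_e}}{ds^v}\big((\beta-c)r_1^\alpha\big)\Big)\Big]f_{d_1}(r_1)f_{d_e}(r_e)\,dr_1\,dr_e.$$ 5. The secrecy rate $\max\{D,0\}\mathbf 1_{\Phi(\mathcal A)\ge1}$ is integrable, $F^c$ is integrable on $(0,\infty)$, and $R^{\sf sec}=\int_0^\infty F^c(\gamma)\,d\gamma$. -/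

import Mathlib

open MeasureTheory ProbabilityTheory
open scoped Nat

noncomputable section

namespace SatSecrecy

/-- Three-dimensional Euclidean space. -/
abbrev E3 : Type := EuclideanSpace ℝ (Fin 3)

/-! ### Geometry of spheres -/

/-- The surface area measure of the sphere of radius `R` centred at the origin, as a measure
on `E3` (total mass `4 π R ^ 2`). -/
def sphereArea (R : ℝ) : Measure E3 :=
  ENNReal.ofReal (R ^ 2) •
    ((volume : Measure E3).toSphere.map fun s : Metric.sphere (0 : E3) 1 => R • (s : E3))

/-- The cap cut from the sphere of radius `R` centred at the origin by the plane that is orthogonal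
to `v` and lies at distance `h` from the origin, on the side of `v`. -/
def cap (R : ℝ) (v : E3) (h : ℝ) : Set E3 :=
  {y | ‖y‖ = R ∧ h * ‖v‖ ≤ inner ℝ y v}

/-! ### Finite point processes and Poisson processes -/

/-- A finite point process in `E3`: a random number `num` of points, numbered
`pt 0, …, pt (num - 1)`. The later values of `pt` play no role. -/
structure PointProcess (Ω : Type*) [MeasurableSpace Ω] where
  num : Ω → ℕ
  pt : ℕ → Ω → E3
  measurable_num : Measurable num
  measurable_pt : ∀ i, Measurable (pt i)

namespace PointProcess

variable {Ω : Type*} [MeasurableSpace Ω]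

open Classical in
/-- The number of points of the process in the set `B`. -/
def count (Φ : PointProcess Ω) (B : Set E3) (ω : Ω) : ℕ :=
  ((Finset.range (Φ.num ω)).filter fun i => Φ.pt i ω ∈ B).card

/-- The σ-algebra generated by the process. -/
abbrev sigma (Φ : PointProcess Ω) : MeasurableSpace Ω :=
  MeasurableSpace.comap Φ.num inferInstance ⊔
    ⨆ i, MeasurableSpace.comap (Φ.pt i) inferInstance

/-- The process is a Poisson point process with finite intensity measure `ν`: the number of points
in a Borel set `B` is Poisson with mean `ν B`, and the numbers of points in pairwise disjoint Borel
sets are independent. -/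
structure IsPoisson (Φ : PointProcess Ω) (μ : Measure Ω) (ν : Measure E3) : Prop where
  map_count : ∀ B : Set E3, MeasurableSet B →
    μ.map (Φ.count B) = poissonMeasure (ν B).toNNReal
  indep : ∀ (k : ℕ) (B : Fin k → Set E3), (∀ i, MeasurableSet (B i)) →
    (∀ i j, i ≠ j → Disjoint (B i) (B j)) → iIndepFun (fun i => Φ.count (B i)) μ

/-- The index of the point of the process that is nearest to `y` (the least one in case of a tie,
and `0` if there is no point). -/
def nearestIdx (Φ : PointProcess Ω) (y : E3) (ω : Ω) : ℕ :=
  sInf {i | i < Φ.num ω ∧ ∀ j < Φ.num ω, dist (Φ.pt i ω) y ≤ dist (Φ.pt j ω) y}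

end PointProcess

/-! ### Shadowed-Rician fading -/

/-- The confluent hypergeometric function of the first kind,
`∑ (a)ₙ / (b)ₙ * zⁿ / n!`. -/
def confluentF (a b z : ℝ) : ℝ :=
  ∑' n : ℕ, (ascPochhammer ℝ n).eval a / (ascPochhammer ℝ n).eval b * (z ^ n / (n ! : ℝ))

/-- The density on `(0, ∞)` of the amplitude of a Shadowed-Rician channel with Nakagami parameter
`m`, average power `2 b` of the scatter component and average power `w` of the line-of-sight
component. -/
def shadowedRicianPDF (m : ℕ) (b w x : ℝ) : ℝ :=
  (2 * b * m / (2 * b * m + w)) ^ m * (x / b) * Real.exp (-x ^ 2 / (2 * b)) *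
    confluentF m 1 (w * x ^ 2 / (2 * b * (2 * b * m + w)))

/-- The random power `H` is such that its amplitude `√H` is Shadowed-Rician. -/
def IsShadowedRicianPower {Ω : Type*} [MeasurableSpace Ω] (μ : Measure Ω) (m : ℕ) (b w : ℝ)
    (H : Ω → ℝ) : Prop :=
  Measurable H ∧
    μ.map (fun ω => Real.sqrt (H ω)) =
      (volume.restrict (Set.Ioi (0 : ℝ))).withDensity
        fun x => ENNReal.ofReal (shadowedRicianPDF m b w x)

/-! ### Parameters of the network -/

/-- The deterministic parameters of the network. -/
structure Params where
  /-- radius of the Earth -/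
  RE : ℝ
  /-- radius of the sphere of the satellites -/
  RS : ℝ
  RE_pos : 0 < RE
  RE_lt_RS : RE < RS
  /-- altitude above the typical user of the plane that cuts the visible cap of satellites -/
  hs : ℝ
  hs_nonneg : 0 ≤ hs
  hs_lt : hs < RS - RE
  /-- distance from the origin of the plane that cuts the cap of eavesdroppers -/
  he : ℝ
  le_he : RE ^ 2 / RS ≤ he
  he_lt : he < RE
  /-- density of the satellites -/
  lam : ℝ
  lam_pos : 0 < lam
  /-- density of the users -/
  lamU : ℝ
  lamU_pos : 0 < lamU
  /-- density of the eavesdroppers -/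
  lamE : ℝ
  lamE_pos : 0 < lamE
  /-- path-loss exponent -/
  α : ℝ
  /-- transmit power of the satellites -/
  Ptx : ℝ
  Ptx_pos : 0 < Ptx
  /-- noise power -/
  noise : ℝ
  noise_pos : 0 < noise
  /-- main-lobe and side-lobe transmit gains, main-lobe receive gain -/
  gTxMain : ℝ
  gTxSide : ℝ
  gRxMain : ℝ
  gTxMain_pos : 0 < gTxMain
  gTxSide_pos : 0 < gTxSide
  gRxMain_pos : 0 < gRxMain
  /-- speed of light and carrier frequency -/
  cLight : ℝ
  fc : ℝ
  cLight_pos : 0 < cLight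
  fc_pos : 0 < fc
  /-- effective gain from the serving satellite to the eavesdroppers: either the main-lobe gain or
  the side-lobe gain -/
  Ge : ℝ
  Ge_eq : Ge = gTxMain * gRxMain * (cLight ^ 2 / (4 * Real.pi * fc) ^ 2) ∨
    Ge = gTxSide * gRxMain * (cLight ^ 2 / (4 * Real.pi * fc) ^ 2)
  /-- Nakagami parameter of the fading, a positive integer -/
  m : ℕ
  m_pos : 1 ≤ m
  /-- half of the average power of the scatter component -/
  b : ℝ
  b_pos : 0 < b
  /-- average power of the line-of-sight component -/
  w : ℝ
  w_nonneg : 0 ≤ w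

namespace Params

variable (p : Params)

/-- Effective antenna gain from the serving satellite to the typical user. -/
def G : ℝ := p.gTxMain * p.gRxMain * (p.cLight ^ 2 / (4 * Real.pi * p.fc) ^ 2)

/-- The normalized noise power `σ² / (P G)`. -/
def sbar : ℝ := p.noise / (p.Ptx * p.G)

/-- The relative gain `Gₑ / G` of the eavesdroppers. -/
def Gbar : ℝ := p.Ge / p.G

/-- The location `(0, 0, RE)` of the typical user. -/
def typicalUser : E3 := !₂[0, 0, p.RE]

/-- The visible spherical cap of satellites. -/
def capSat : Set E3 := cap p.RS p.typicalUser (p.RE + p.hs)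

/-- The spherical cap of potential eavesdroppers when the serving satellite is at `x`: the footprint
of the satellite. -/
def capEve (x : E3) : Set E3 := cap p.RE x p.he

end Params

/-! ### The random network -/

/-- The random network: satellites, users and eavesdroppers form independent homogeneous Poisson
processes on their spheres, independent of the fading, which is Shadowed-Rician. One user, the
typical one, is fixed at `p.typicalUser`; `users` is the process of all the other users (the reduced
Palm version, which has the law of the process itself). -/
structure Network (p : Params) {Ω : Type*} [MeasurableSpace Ω] (μ : Measure Ω) where
  sats : PointProcess Ω
  users : PointProcess Ω
  eves : PointProcess Ω
  /-- fading power from the `i`-th satellite to the typical user -/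
  HU : ℕ → Ω → ℝ
  /-- fading power from the serving satellite to the `n`-th eavesdropper -/
  HE : ℕ → Ω → ℝ
  sats_poisson : sats.IsPoisson μ (ENNReal.ofReal p.lam • sphereArea p.RS)
  users_poisson : users.IsPoisson μ (ENNReal.ofReal p.lamU • sphereArea p.RE)
  eves_poisson : eves.IsPoisson μ (ENNReal.ofReal p.lamE • sphereArea p.RE)
  HU_law : ∀ i, IsShadowedRicianPower μ p.m p.b p.w (HU i)
  HE_law : ∀ n, IsShadowedRicianPower μ p.m p.b p.w (HE n)
  indep : iIndep ![sats.sigma, users.sigma, eves.sigma,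
    ⨆ i, MeasurableSpace.comap (HU i) inferInstance,
    ⨆ n, MeasurableSpace.comap (HE n) inferInstance] μ

namespace Network

variable {p : Params} {Ω : Type*} [MeasurableSpace Ω] {μ : Measure Ω} (N : Network p μ)

/-- Location of the satellite nearest to the typical user. -/
def servingSat (ω : Ω) : E3 := N.sats.pt (N.sats.nearestIdx p.typicalUser ω) ω

/-- Fading power from the nearest satellite to the typical user. -/
def fadingUser (ω : Ω) : ℝ := N.HU (N.sats.nearestIdx p.typicalUser ω) ω

/-- Location of the eavesdropper nearest to the serving satellite. -/
def nearestEve (ω : Ω) : E3 := N.eves.pt (N.eves.nearestIdx (N.servingSat ω) ω) ω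

/-- Fading power from the serving satellite to the nearest eavesdropper. -/
def fadingEve (ω : Ω) : ℝ := N.HE (N.eves.nearestIdx (N.servingSat ω) ω) ω

/-- Distance from the serving satellite to the typical user. -/
def distUser (ω : Ω) : ℝ := dist (N.servingSat ω) p.typicalUser

/-- Distance from the serving satellite to the nearest eavesdropper. -/
def distEve (ω : Ω) : ℝ := dist (N.servingSat ω) (N.nearestEve ω)

/-- At least one satellite is visible. -/
def served : Set Ω := {ω | 1 ≤ N.sats.count p.capSat ω}

/-- At least one satellite is visible, and no eavesdropper is in the footprint. -/
def servedNoEve : Set Ω :=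
  {ω | ω ∈ N.served ∧ N.eves.count (p.capEve (N.servingSat ω)) ω = 0}

/-- At least one satellite is visible, and at least one eavesdropper is in the footprint. -/
def servedEve : Set Ω :=
  {ω | ω ∈ N.served ∧ 1 ≤ N.eves.count (p.capEve (N.servingSat ω)) ω}

/-- Rate of the link from the serving satellite to the typical user. -/
def rateUser (ω : Ω) : ℝ :=
  Real.logb 2 (1 + p.G * p.Ptx * N.fadingUser ω * N.distUser ω ^ (-p.α) / p.noise)

open Classical in
/-- Rate of the link from the serving satellite to the nearest eavesdropper in the footprint;
it is zero when there is none. -/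
def rateEve (ω : Ω) : ℝ :=
  if 1 ≤ N.eves.count (p.capEve (N.servingSat ω)) ω then
    Real.logb 2 (1 + p.Ge * p.Ptx * N.fadingEve ω * N.distEve ω ^ (-p.α) / p.noise)
  else 0

open Classical in
/-- The secrecy rate of the typical user; it is zero when no satellite is visible. -/
def secrecyRate (ω : Ω) : ℝ :=
  if ω ∈ N.served then max (N.rateUser ω - N.rateEve ω) 0 else 0

/-- The ergodic secrecy rate of the typical user. -/
def ergodicSecrecyRate : ℝ := ∫ ω, N.secrecyRate ω ∂μ

/-- The event that the typical user is served and the difference of the rates is at least `γ`. -/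
def exceeds (γ : ℝ) : Set Ω := {ω | ω ∈ N.served ∧ γ ≤ N.rateUser ω - N.rateEve ω}

end Network

/-! ### The closed form -/

namespace Params

variable (p : Params)

def lamT : ℝ := p.lam * (p.RS / p.RE)

def lamET : ℝ := p.lamE * (p.RE / p.RS)

/-- The least distance from a satellite to a point of the Earth. -/
def Rmin : ℝ := p.RS - p.RE

/-- The largest distance from the typical user to a visible satellite. -/
def RmaxU : ℝ := Real.sqrt (p.RS ^ 2 - p.RE ^ 2 - 2 * p.RE * p.hs)

/-- The largest distance from a satellite to a point of its footprint. -/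
def RmaxE : ℝ := Real.sqrt (p.RS ^ 2 + p.RE ^ 2 - 2 * p.RS * p.he)

/-- The probability that no satellite is visible. -/
def voidU : ℝ := Real.exp (-(p.lamT * Real.pi * (p.RmaxU ^ 2 - p.Rmin ^ 2)))

/-- The probability that no eavesdropper is in the footprint. -/
def voidE : ℝ := Real.exp (-(p.lamET * Real.pi * (p.RmaxE ^ 2 - p.Rmin ^ 2)))

/-- The truncated Rayleigh density, on `[Rmin, RmaxU]`, of the distance to the serving satellite. -/
def densU (r : ℝ) : ℝ :=
  2 * p.lamT * Real.pi * Real.exp (p.lamT * Real.pi * p.Rmin ^ 2) / (1 - p.voidU) *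
    (r * Real.exp (-(p.lamT * Real.pi * r ^ 2)))

/-- The truncated Rayleigh density, on `[Rmin, RmaxE]`, of the distance from the serving satellite to
the nearest eavesdropper. -/
def densE (r : ℝ) : ℝ :=
  2 * p.lamET * Real.pi * Real.exp (p.lamET * Real.pi * p.Rmin ^ 2) / (1 - p.voidE) *
    (r * Real.exp (-(p.lamET * Real.pi * r ^ 2)))

def β : ℝ := 1 / (2 * p.b)

def c : ℝ := p.w / (2 * p.b * (2 * p.b * p.m + p.w))

def ζ (z : ℕ) : ℝ :=
  (2 * p.b * p.m / (2 * p.b * p.m + p.w)) ^ p.m *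
    (p.β * (-1) ^ z * (ascPochhammer ℝ z).eval (1 - p.m : ℝ) * p.c ^ z / (z ! : ℝ) ^ 2)

/-- The Laplace transform at `s` of `2 ^ γ * L - sbar`, where `L = sbar + Gbar * H * r ^ (-α)` is
the power of signal plus noise at an eavesdropper at distance `r`. -/
def laplace (γ r s : ℝ) : ℝ :=
  Real.exp (-(s * ((2 : ℝ) ^ γ * p.sbar - p.sbar))) *
    ∑ z ∈ Finset.range p.m, p.ζ z *
      (Real.Gamma (z + 1) / (p.β - p.c + s * (2 : ℝ) ^ γ * p.Gbar * r ^ (-p.α)) ^ (z + 1))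

/-- The conditional CCDF when no eavesdropper is in the footprint. -/
def ccdfNoEve (γ : ℝ) : ℝ :=
  ∫ r₁ in p.Rmin..p.RmaxU,
    (1 - ∑ z ∈ Finset.range p.m, p.ζ z * Real.Gamma (z + 1) / (p.β - p.c) ^ (z + 1) *
      (1 - Real.exp (-((p.β - p.c) * ((2 : ℝ) ^ γ - 1) * p.sbar * r₁ ^ p.α)) *
        ∑ v ∈ Finset.range (z + 1),
          (p.β - p.c) ^ v * (((2 : ℝ) ^ γ - 1) * p.sbar * r₁ ^ p.α) ^ v / (v ! : ℝ))) *
    p.densU r₁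

/-- The conditional CCDF when at least one eavesdropper is in the footprint. -/
def ccdfEve (γ : ℝ) : ℝ :=
  ∫ rₑ in p.Rmin..p.RmaxE, ∫ r₁ in p.Rmin..p.RmaxU,
    (1 - ∑ z ∈ Finset.range p.m, p.ζ z * Real.Gamma (z + 1) / (p.β - p.c) ^ (z + 1) *
      (1 - ∑ v ∈ Finset.range (z + 1),
        (p.β - p.c) ^ v * (r₁ ^ p.α) ^ v / (v ! : ℝ) * (-1) ^ v *
          iteratedDeriv v (fun s => p.laplace γ rₑ s) ((p.β - p.c) * r₁ ^ p.α))) *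
    p.densU r₁ * p.densE rₑ

/-- The CCDF of the secrecy rate. -/
def ccdf (γ : ℝ) : ℝ :=
  (1 - p.voidU) * p.voidE * p.ccdfNoEve γ + (1 - p.voidU) * (1 - p.voidE) * p.ccdfEve γ

end Params

end SatSecrecy

end

/-!
The theorem splits into the geometry of the nearest points and the law of the fading.

**Nearest points.** By Archimedes' theorem (`sphereArea_cap`) the part of a sphere within distance
`r` of a point has an area that is affine in `r ^ 2`. The distance from a point to a Poisson
process on a sphere exceeds `r` exactly when the process has no point in this cap, so the void
probabilities give a truncated Rayleigh law (`PointProcess.IsPoisson.map_dist_nearest`). It is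
applied to the satellites seen from the user and, because the law depends on the centre only
through its norm, to the eavesdroppers seen from the random serving satellite: conditionally on
the satellites, neither the probability of an empty footprint nor the law of the nearest
eavesdropper depends on where the satellite is. `map_restrict_prod_of_fiber` turns this into a
product law. The same lemma shows that a fading power whose index is chosen by the point processes
is independent of them. So, given that the footprint contains an eavesdropper, the two distances
and the two fading powers are independent (`Network.cond_map_servedEve`).

**Fading.** For an integer Nakagami parameter Kummer's transformation makes the confluent
hypergeometric function an exponential times a polynomial (`confluentF_succ_one`), and the power of
the channel is a mixture of Gamma variables (`IsShadowedRicianPower.map_eq`). This gives its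
distribution function and its Laplace transform. A secrecy rate of at least `γ` means that the power
received by the user is at least a threshold `Y` that depends on the eavesdropper
(`Params.le_rate_sub_rate_iff`). The distribution function produces the moments
`E[Y ^ v * exp (-s * Y)]`, which up to sign are the derivatives of the Laplace transform of `Y`
(`Params.iteratedDeriv_laplace`).

The ergodic rate is the integral of the complementary distribution function by the layer cake
formula; integrability holds because the rate is at most a multiple of the fading power.
-/

noncomputable section

namespace SatSecrecy

/-! ### The area of a spherical cap -/

/-- The point of `E3` at height `q.1` above the point `q.2` of the plane; the height is the
coordinate `0`. -/
def ofHeight (q : ℝ × EuclideanSpace ℝ (Fin 2)) : E3 :=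
  WithLp.toLp 2 (Fin.cons q.1 (WithLp.ofLp q.2))

lemma measurePreserving_ofHeight : MeasurePreserving ofHeight :=
  (PiLp.volume_preserving_toLp (Fin 3)).comp
    (by
      convert ((volume_preserving_piFinSuccAbove (fun _ => ℝ) (0 : Fin 3)).symm).comp
        ((MeasurePreserving.id volume).prod (PiLp.volume_preserving_ofLp (Fin 2))) using 1
      · funext q
        simp [MeasurableEquiv.piFinSuccAbove, Fin.consEquiv]
      · exact Measure.volume_eq_prod _ _)

lemma norm_sq_ofHeight (q : ℝ × EuclideanSpace ℝ (Fin 2)) :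
    ‖ofHeight q‖ ^ 2 = q.1 ^ 2 + ‖q.2‖ ^ 2 := by
  simp [EuclideanSpace.norm_sq_eq, ofHeight, Fin.sum_univ_succ]

lemma measurableSet_cone (h : ℝ) (v : E3) :
    MeasurableSet {x : E3 | x ≠ 0 ∧ ‖x‖ < 1 ∧ h * ‖x‖ ≤ inner ℝ x v} := by
  have h2 : MeasurableSet {x : E3 | ‖x‖ < 1} := measurableSet_lt (by fun_prop) (by fun_prop)
  have h3 : MeasurableSet {x : E3 | h * ‖x‖ ≤ inner ℝ x v} :=
    measurableSet_le (by fun_prop) (by fun_prop)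
  exact (measurableSet_singleton (0 : E3)).compl.inter (h2.inter h3)

/-- The slice at height `z` of a circular cone truncated by the unit ball is a disk: its radius is
governed by the cone below height `h` and by the ball above. -/
lemma volume_slice_cone {h : ℝ} (h0 : 0 < h) (h1 : h ≤ 1) (z : ℝ) :
    volume {w : EuclideanSpace ℝ (Fin 2) | ofHeight (z, w) ≠ 0 ∧ ‖ofHeight (z, w)‖ < 1 ∧
        h * ‖ofHeight (z, w)‖ ≤ z} =
      (Set.Ioc 0 h).indicator (fun z => ENNReal.ofReal (Real.pi * (z ^ 2 * (1 / h ^ 2 - 1)))) z +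
      (Set.Ioc h 1).indicator (fun z => ENNReal.ofReal (Real.pi * (1 - z ^ 2))) z := by
  have key : ∀ w : EuclideanSpace ℝ (Fin 2), ‖ofHeight (z, w)‖ ^ 2 = z ^ 2 + ‖w‖ ^ 2 :=
    fun w => norm_sq_ofHeight (z, w)
  rcases le_or_gt z 0 with hz | hz
  · have : {w : EuclideanSpace ℝ (Fin 2) | ofHeight (z, w) ≠ 0 ∧ ‖ofHeight (z, w)‖ < 1 ∧
        h * ‖ofHeight (z, w)‖ ≤ z} = ∅ := by
      ext w
      simp only [Set.mem_ofPred_eq, Set.mem_empty_iff_false, iff_false]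
      rintro ⟨a, -, c⟩
      have := mul_pos h0 (norm_pos_iff.2 a)
      linarith
    rw [this, Set.indicator_of_notMem (by simp; intro; linarith),
      Set.indicator_of_notMem (by simp; intro; linarith)]
    simp
  have hne : ∀ w : EuclideanSpace ℝ (Fin 2), ofHeight (z, w) ≠ 0 := by
    intro w hw
    have := key w
    rw [hw] at this
    simp only [norm_zero] at this
    nlinarith [sq_nonneg ‖w‖]
  rcases le_or_gt z h with hzh | hzh
  · have hh : (0:ℝ) ≤ 1 / h ^ 2 - 1 := by
      rw [sub_nonneg, le_div_iff₀ (by positivity)]; nlinarith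
    have : {w : EuclideanSpace ℝ (Fin 2) | ofHeight (z, w) ≠ 0 ∧ ‖ofHeight (z, w)‖ < 1 ∧
        h * ‖ofHeight (z, w)‖ ≤ z} ⊆ Metric.closedBall 0 (Real.sqrt (z ^ 2 * (1 / h ^ 2 - 1))) := by
      rintro w ⟨-, -, c⟩
      rw [mem_closedBall_zero_iff]
      apply Real.le_sqrt_of_sq_le
      have h2 : ‖ofHeight (z, w)‖ ≤ z / h := by rw [le_div_iff₀ h0]; linarith
      have h3 : ‖ofHeight (z, w)‖ ^ 2 ≤ (z / h) ^ 2 := by gcongr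
      rw [key, div_pow] at h3
      have : z ^ 2 * (1 / h ^ 2 - 1) = z ^ 2 / h ^ 2 - z ^ 2 := by ring
      linarith
    have h' : Metric.ball 0 (Real.sqrt (z ^ 2 * (1 / h ^ 2 - 1))) ⊆
        {w : EuclideanSpace ℝ (Fin 2) | ofHeight (z, w) ≠ 0 ∧ ‖ofHeight (z, w)‖ < 1 ∧
        h * ‖ofHeight (z, w)‖ ≤ z} := by
      intro w hw
      rw [mem_ball_zero_iff, Real.lt_sqrt (norm_nonneg _)] at hw
      have h3 : ‖ofHeight (z, w)‖ ^ 2 < (z / h) ^ 2 := by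
        rw [key, div_pow]
        have : z ^ 2 * (1 / h ^ 2 - 1) = z ^ 2 / h ^ 2 - z ^ 2 := by ring
        linarith
      have h4 := lt_of_pow_lt_pow_left₀ 2 (by positivity) h3
      have h5 : z / h ≤ 1 := by rw [div_le_one h0]; exact hzh
      refine ⟨hne w, by linarith, ?_⟩
      rw [lt_div_iff₀ h0] at h4
      linarith
    rw [Set.indicator_of_mem (by exact ⟨hz, hzh⟩),
      Set.indicator_of_notMem (by simp; intro; linarith), add_zero]
    have e : ENNReal.ofReal (Real.sqrt (z ^ 2 * (1 / h ^ 2 - 1))) ^ 2 * ENNReal.ofReal Real.pi =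
        ENNReal.ofReal (Real.pi * (z ^ 2 * (1 / h ^ 2 - 1))) := by
      rw [← ENNReal.ofReal_pow (Real.sqrt_nonneg _), Real.sq_sqrt (by positivity),
        mul_comm, ← ENNReal.ofReal_mul Real.pi_pos.le]
    apply le_antisymm
    · refine (measure_mono this).trans_eq ?_
      rw [EuclideanSpace.volume_closedBall_fin_two, e]
    · refine le_trans (le_of_eq ?_) (measure_mono h')
      rw [EuclideanSpace.volume_ball_fin_two, e]
  · rw [Set.indicator_of_notMem (by simp; intro; linarith), zero_add]
    have : {w : EuclideanSpace ℝ (Fin 2) | ofHeight (z, w) ≠ 0 ∧ ‖ofHeight (z, w)‖ < 1 ∧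
        h * ‖ofHeight (z, w)‖ ≤ z} = Metric.ball 0 (Real.sqrt (1 - z ^ 2)) := by
      ext w
      rw [mem_ball_zero_iff, Real.lt_sqrt (norm_nonneg _)]
      constructor
      · rintro ⟨-, c, -⟩
        have := pow_lt_one₀ (norm_nonneg _) c two_ne_zero
        rw [key] at this
        linarith
      · intro hw
        have : ‖ofHeight (z, w)‖ < 1 := by
          refine lt_of_pow_lt_pow_left₀ 2 zero_le_one ?_
          rw [key]
          linarith
        refine ⟨hne w, this, ?_⟩
        nlinarith
    rw [this, EuclideanSpace.volume_ball_fin_two]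
    rcases le_or_gt z 1 with h1 | h1
    · rw [Set.indicator_of_mem (by exact ⟨hzh, h1⟩), ← ENNReal.ofReal_pow (Real.sqrt_nonneg _),
        Real.sq_sqrt (by nlinarith), mul_comm, ← ENNReal.ofReal_mul Real.pi_pos.le]
    · rw [Set.indicator_of_notMem (by simp; intro; linarith),
        Real.sqrt_eq_zero_of_nonpos (by nlinarith)]
      simp

lemma volume_cone_single {h : ℝ} (h0 : 0 < h) (h1 : h ≤ 1) :
    volume {x : E3 | x ≠ 0 ∧ ‖x‖ < 1 ∧ h * ‖x‖ ≤ inner ℝ x (EuclideanSpace.single 0 1)} =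
      ENNReal.ofReal (2 * Real.pi / 3 * (1 - h)) := by
  rw [← measurePreserving_ofHeight.measure_preimage (measurableSet_cone h _).nullMeasurableSet,
    Measure.volume_eq_prod, Measure.prod_apply
      (measurePreserving_ofHeight.measurable (measurableSet_cone h _))]
  have hs : ∀ z : ℝ, (volume (Prod.mk z ⁻¹' (ofHeight ⁻¹'
      {x : E3 | x ≠ 0 ∧ ‖x‖ < 1 ∧ h * ‖x‖ ≤ inner ℝ x (EuclideanSpace.single 0 1)}))) =
      (Set.Ioc 0 h).indicator (fun z => ENNReal.ofReal (Real.pi * (z ^ 2 * (1 / h ^ 2 - 1)))) z +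
      (Set.Ioc h 1).indicator (fun z => ENNReal.ofReal (Real.pi * (1 - z ^ 2))) z := by
    intro z
    rw [← volume_slice_cone h0 h1]
    congr 1
    ext w
    simp [EuclideanSpace.inner_single_right, ofHeight]
  have hh : (1:ℝ) ≤ 1 / h ^ 2 := by
    rw [le_div_iff₀ (by positivity)]; nlinarith
  simp_rw [hs]
  rw [lintegral_add_left (by measurability), lintegral_indicator measurableSet_Ioc,
    lintegral_indicator measurableSet_Ioc, ← ofReal_integral_eq_lintegral_ofReal,
    ← ofReal_integral_eq_lintegral_ofReal, ← intervalIntegral.integral_of_le h0.le,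
    ← intervalIntegral.integral_of_le h1, ← ENNReal.ofReal_add]
  · congr 1
    have : ∫ (x : ℝ) in (0:ℝ)..h, Real.pi * (x ^ 2 * (1 / h ^ 2 - 1)) =
        Real.pi * ((1 / h ^ 2 - 1) * (h ^ 3 / 3)) := by
      simp; ring
    rw [this]
    have : ∫ (x : ℝ) in h..1, Real.pi * (1 - x ^ 2) =
        Real.pi * ((1 - h) - (1 - h ^ 3) / 3) := by
      rw [intervalIntegral.integral_const_mul, intervalIntegral.integral_sub (by simp) (by simp)]
      simp
      ring
    rw [this]
    field_simp
    ring
  · apply intervalIntegral.integral_nonneg h0.le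
    intro u hu
    have := sub_nonneg.2 hh
    positivity
  · apply intervalIntegral.integral_nonneg h1
    intro u hu
    have : 0 ≤ 1 - u ^ 2 := by nlinarith [hu.1, hu.2]
    positivity
  · exact (Continuous.integrableOn_Ioc (by fun_prop))
  · refine (ae_restrict_iff' measurableSet_Ioc).2 (.of_forall fun u hu => ?_)
    have : 0 ≤ 1 - u ^ 2 := by nlinarith [hu.1, hu.2]
    simp only [Pi.zero_apply]
    positivity
  · exact (Continuous.integrableOn_Ioc (by fun_prop))
  · refine .of_forall fun u => ?_
    have := sub_nonneg.2 hh
    simp only [Pi.zero_apply]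
    positivity

/-- Volume of a truncated cone with an arbitrary axis: a reflection moves the axis to a coordinate
axis. -/
lemma volume_cone {h : ℝ} (h0 : 0 < h) (h1 : h ≤ 1) {v : E3} (hv : ‖v‖ = 1) :
    volume {x : E3 | x ≠ 0 ∧ ‖x‖ < 1 ∧ h * ‖x‖ ≤ inner ℝ x v} =
      ENNReal.ofReal (2 * Real.pi / 3 * (1 - h)) := by
  rw [← volume_cone_single h0 h1]
  have hn : ‖(EuclideanSpace.single 0 1 : E3)‖ = ‖v‖ := by simp [hv]
  set ρ := (Submodule.span ℝ {(EuclideanSpace.single 0 1 : E3) - v})ᗮ.reflection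
  have hρ : ρ (EuclideanSpace.single 0 1) = v := Submodule.reflection_sub hn
  rw [← ρ.measurePreserving.measure_preimage (measurableSet_cone h v).nullMeasurableSet]
  congr 1
  ext x
  simp only [Set.mem_preimage, Set.mem_ofPred_eq, ρ.norm_map, ← hρ, ρ.inner_map_map, ne_eq,
    map_eq_zero_iff ρ ρ.injective]

lemma measurableSet_cap (R : ℝ) (v : E3) (h : ℝ) : MeasurableSet (cap R v h) := by
  have h1 : MeasurableSet {y : E3 | ‖y‖ = R} := measurableSet_eq_fun (by fun_prop) (by fun_prop)
  have h2 : MeasurableSet {y : E3 | h * ‖v‖ ≤ inner ℝ y v} :=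
    measurableSet_le (by fun_prop) (by fun_prop)
  exact h1.inter h2

lemma sphereArea_apply (R : ℝ) {B : Set E3} (hB : MeasurableSet B) :
    sphereArea R B = ENNReal.ofReal (R ^ 2) *
      (volume : Measure E3).toSphere {s | R • (s : E3) ∈ B} := by
  have : Measurable fun s : Metric.sphere (0 : E3) 1 => R • (s : E3) := by fun_prop
  rw [sphereArea, Measure.smul_apply, smul_eq_mul, Measure.map_apply this hB]
  rfl

/-- The measure `sphereArea R` is carried by the sphere. -/
lemma sphereArea_compl_sphere {R : ℝ} (hR : 0 ≤ R) : sphereArea R {y | ‖y‖ ≠ R} = 0 := by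
  have h1 : MeasurableSet {y : E3 | ‖y‖ = R} := measurableSet_eq_fun (by fun_prop) (by fun_prop)
  rw [← Set.compl_ofPred, sphereArea_apply R h1.compl]
  have : {s : Metric.sphere (0 : E3) 1 | R • (s : E3) ∈ {y : E3 | ‖y‖ = R}ᶜ} = ∅ := by
    ext s
    simp [norm_smul, abs_of_nonneg hR]
  rw [this]
  simp

open scoped Pointwise in
/-- **Archimedes' theorem**: the area of a spherical cap is `2 π R (R - h)`. -/
lemma sphereArea_cap {R h : ℝ} (h0 : 0 < h) (hR : h ≤ R) {v : E3} (hv : v ≠ 0) :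
    sphereArea R (cap R v h) = ENNReal.ofReal (2 * Real.pi * R * (R - h)) := by
  have hR0 : 0 < R := by linarith
  have hv0 : 0 < ‖v‖ := norm_pos_iff.2 hv
  have hm : MeasurableSet {s : Metric.sphere (0 : E3) 1 | R • (s : E3) ∈ cap R v h} := by
    have : Measurable fun s : Metric.sphere (0 : E3) 1 => R • (s : E3) := by fun_prop
    exact this (measurableSet_cap R v h)
  rw [sphereArea_apply R (measurableSet_cap R v h), Measure.toSphere_apply' _ hm]
  have hset : (Set.Ioo (0 : ℝ) 1 •
      (Subtype.val '' {s : Metric.sphere (0 : E3) 1 | R • (s : E3) ∈ cap R v h}) : Set E3) =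
      {x : E3 | x ≠ 0 ∧ ‖x‖ < 1 ∧ h / R * ‖x‖ ≤ inner ℝ x (‖v‖⁻¹ • v)} := by
    ext x
    simp only [Set.mem_smul, Set.mem_image, Set.mem_ofPred_eq, cap]
    constructor
    · rintro ⟨t, ht, _, ⟨s, ⟨-, hs⟩, rfl⟩, rfl⟩
      have hsn : ‖(s : E3)‖ = 1 := by simp
      refine ⟨smul_ne_zero ht.1.ne' (by rw [← norm_pos_iff, hsn]; exact one_pos), ?_, ?_⟩
      · rw [norm_smul, hsn, mul_one, Real.norm_of_nonneg ht.1.le]; exact ht.2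
      · rw [norm_smul, hsn, mul_one, Real.norm_of_nonneg ht.1.le, real_inner_smul_left,
          real_inner_smul_right]
        rw [real_inner_smul_left] at hs
        rw [div_mul_eq_mul_div, div_le_iff₀ hR0]
        have h2 : h ≤ ‖v‖⁻¹ * inner ℝ (s : E3) v * R := by
          rw [mul_assoc, inv_mul_eq_div, le_div_iff₀ hv0]; linarith
        nlinarith [ht.1]
    · rintro ⟨hx, hx1, hxi⟩
      have hx0 : 0 < ‖x‖ := norm_pos_iff.2 hx
      refine ⟨‖x‖, ⟨hx0, hx1⟩, ‖x‖⁻¹ • x,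
        ⟨⟨‖x‖⁻¹ • x, by simp [norm_smul, hx0.ne']⟩, ⟨?_, ?_⟩, rfl⟩, ?_⟩
      · simp [norm_smul, hx0.ne', abs_of_pos hR0]
      · rw [real_inner_smul_right, div_mul_eq_mul_div, div_le_iff₀ hR0, mul_assoc,
          inv_mul_eq_div, le_div_iff₀ hv0] at hxi
        rw [real_inner_smul_left, real_inner_smul_left, mul_left_comm, inv_mul_eq_div,
          le_div_iff₀ hx0]
        linarith
      · rw [smul_smul, mul_inv_cancel₀ hx0.ne', one_smul]
  have hc : h / R ≤ 1 := by rw [div_le_one hR0]; exact hR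
  have hc0 : 0 ≤ 1 - h / R := sub_nonneg.2 hc
  rw [hset, volume_cone (by positivity) hc (by simp [norm_smul, hv0.ne'])]
  have : ((Module.finrank ℝ E3 : ℕ) : ENNReal) = ENNReal.ofReal 3 := by simp
  rw [this, ← ENNReal.ofReal_mul (by norm_num), ← ENNReal.ofReal_mul (by positivity)]
  congr 1
  field_simp

/-! ### Nearest points of a finite point process -/

namespace PointProcess

section

variable {Ω : Type*} [MeasurableSpace Ω] (Φ : PointProcess Ω)

lemma one_le_count_iff (B : Set E3) (ω : Ω) :
    1 ≤ Φ.count B ω ↔ ∃ i < Φ.num ω, Φ.pt i ω ∈ B := by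
  rw [count, Nat.one_le_iff_ne_zero, Finset.card_ne_zero]
  simp [Finset.Nonempty]

lemma nearestIdx_spec (y : E3) {ω : Ω} (h : 0 < Φ.num ω) :
    Φ.nearestIdx y ω < Φ.num ω ∧
      ∀ j < Φ.num ω, dist (Φ.pt (Φ.nearestIdx y ω) ω) y ≤ dist (Φ.pt j ω) y := by
  have hne : {i | i < Φ.num ω ∧ ∀ j < Φ.num ω, dist (Φ.pt i ω) y ≤ dist (Φ.pt j ω) y}.Nonempty := by
    obtain ⟨i, hi, hmin⟩ := Finset.exists_min_image (Finset.range (Φ.num ω))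
      (fun i => dist (Φ.pt i ω) y) ⟨0, by simpa using h⟩
    exact ⟨i, by simpa using hi, fun j hj => hmin j (by simpa using hj)⟩
  exact Nat.sInf_mem hne

/-- The event that a random Borel set contains a point of the process is measurable. -/
lemma measurableSet_one_le_count {B : Ω → Set E3}
    (hB : MeasurableSet {q : Ω × E3 | q.2 ∈ B q.1}) :
    MeasurableSet {ω | 1 ≤ Φ.count (B ω) ω} := by
  simp_rw [one_le_count_iff]
  have : {ω | ∃ i < Φ.num ω, Φ.pt i ω ∈ B ω} =
      ⋃ i, {ω | i < Φ.num ω} ∩ (fun ω => (ω, Φ.pt i ω)) ⁻¹' {q : Ω × E3 | q.2 ∈ B q.1} := by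
    ext ω; simp
  rw [this]
  refine .iUnion fun i => .inter ?_ ((measurable_id.prodMk (Φ.measurable_pt i)) hB)
  exact measurableSet_lt measurable_const Φ.measurable_num

/-- The index of the nearest point is measurable, also for a random centre. -/
lemma measurable_nearestIdx {y : Ω → E3} (hy : Measurable y) :
    Measurable fun ω => Φ.nearestIdx (y ω) ω := by
  have hm : ∀ i, MeasurableSet {ω | i < Φ.num ω ∧
      ∀ j, j < Φ.num ω → dist (Φ.pt i ω) (y ω) ≤ dist (Φ.pt j ω) (y ω)} := by
    intro i
    have h1 : ∀ j, MeasurableSet {ω | j < Φ.num ω} :=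
      fun j => measurableSet_lt measurable_const Φ.measurable_num
    have h2 : ∀ j, MeasurableSet {ω | dist (Φ.pt i ω) (y ω) ≤ dist (Φ.pt j ω) (y ω)} := fun j =>
      measurableSet_le ((Φ.measurable_pt i).dist hy) ((Φ.measurable_pt j).dist hy)
    refine (h1 i).inter ?_
    change MeasurableSet {ω | ∀ j, j < Φ.num ω → dist (Φ.pt i ω) (y ω) ≤ dist (Φ.pt j ω) (y ω)}
    rw [Set.ofPred_forall]
    exact .iInter fun j => (h1 j).imp (h2 j)
  -- The second part of the union is the case without a nearest point, where `sInf ∅ = 0`.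
  refine measurable_to_countable' fun k => ?_
  have : (fun ω => Φ.nearestIdx (y ω) ω) ⁻¹' {k} =
      ({ω | k < Φ.num ω ∧ ∀ j, j < Φ.num ω → dist (Φ.pt k ω) (y ω) ≤ dist (Φ.pt j ω) (y ω)} ∩
        ⋂ i, ⋂ (_ : i < k), {ω | i < Φ.num ω ∧
          ∀ j, j < Φ.num ω → dist (Φ.pt i ω) (y ω) ≤ dist (Φ.pt j ω) (y ω)}ᶜ) ∪
      ({_ω | k = 0} ∩ ⋂ i, {ω | i < Φ.num ω ∧
          ∀ j, j < Φ.num ω → dist (Φ.pt i ω) (y ω) ≤ dist (Φ.pt j ω) (y ω)}ᶜ) := by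
    ext ω
    set S := {i | i < Φ.num ω ∧ ∀ j < Φ.num ω, dist (Φ.pt i ω) (y ω) ≤ dist (Φ.pt j ω) (y ω)}
      with hS
    have hmem : ∀ i, (ω ∈ {ω | i < Φ.num ω ∧
      ∀ j, j < Φ.num ω → dist (Φ.pt i ω) (y ω) ≤ dist (Φ.pt j ω) (y ω)}) ↔ i ∈ S := fun i => Iff.rfl
    simp only [Set.mem_preimage, Set.mem_singleton_iff, Set.mem_union, Set.mem_inter_iff,
      Set.mem_iInter, Set.mem_compl_iff, hmem]
    change sInf S = k ↔ k ∈ S ∧ (∀ i < k, i ∉ S) ∨ k = 0 ∧ ∀ i, i ∉ S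
    constructor
    · rintro rfl
      rcases S.eq_empty_or_nonempty with h | h
      · right; simp [h]
      · exact .inl ⟨Nat.sInf_mem h, fun i hi => Nat.notMem_of_lt_sInf hi⟩
    · rintro (⟨h1, h2⟩ | ⟨rfl, h⟩)
      · refine le_antisymm (Nat.sInf_le h1) ?_
        by_contra! hlt
        exact h2 _ hlt (Nat.sInf_mem ⟨k, h1⟩)
      · simp [Set.eq_empty_of_forall_notMem h]
  rw [this]
  refine .union ((hm k).inter (.iInter fun i => .iInter fun _ => (hm i).compl))
    ((MeasurableSet.const _).inter (.iInter fun i => (hm i).compl))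

lemma measurable_pt_index {I : Ω → ℕ} (hI : Measurable I) : Measurable fun ω => Φ.pt (I ω) ω := by
  have : Measurable fun q : ℕ × Ω => Φ.pt q.1 q.2 :=
    measurable_from_prod_countable_right fun i => Φ.measurable_pt i
  exact this.comp (hI.prodMk measurable_id)

end

end PointProcess

/-! ### Poisson processes on a sphere -/

lemma measurableSet_mem_cap (R h : ℝ) : MeasurableSet {q : E3 × E3 | q.2 ∈ cap R q.1 h} := by
  have h1 : MeasurableSet {q : E3 × E3 | ‖q.2‖ = R} :=
    measurableSet_eq_fun (by fun_prop) (by fun_prop)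
  have h2 : MeasurableSet {q : E3 × E3 | h * ‖q.1‖ ≤ inner ℝ q.2 q.1} :=
    measurableSet_le (by fun_prop) (by fun_prop)
  exact h1.inter h2

/-- The points of a cap are the points of the sphere within a given distance of the centre. -/
lemma mem_cap_iff_dist_le {R ρ t : ℝ} (hρ : 0 < ρ) (ht : 0 ≤ t) {x y : E3} (hx : ‖x‖ = R)
    (hy : ‖y‖ = ρ) : x ∈ cap R y ((R ^ 2 + ρ ^ 2 - t ^ 2) / (2 * ρ)) ↔ dist x y ≤ t := by
  have h : dist x y ^ 2 = R ^ 2 + ρ ^ 2 - 2 * inner ℝ x y := by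
    rw [dist_eq_norm, norm_sub_sq_real, hx, hy]; ring
  have e : (R ^ 2 + ρ ^ 2 - t ^ 2) / (2 * ρ) * ρ = (R ^ 2 + ρ ^ 2 - t ^ 2) / 2 := by field_simp
  rw [← sq_le_sq₀ dist_nonneg ht, h]
  simp only [cap, Set.mem_ofPred_eq, hx, hy, e, true_and]
  constructor <;> intro <;> linarith

namespace PointProcess.IsPoisson

variable {Ω : Type*} [MeasurableSpace Ω] {μ : Measure Ω} {Φ : PointProcess Ω} {ν : Measure E3}

lemma measure_count_eq_zero (hΦ : Φ.IsPoisson μ ν) {B : Set E3} (hB : MeasurableSet B) :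
    μ {ω | Φ.count B ω = 0} = ENNReal.ofReal (Real.exp (-(ν B).toReal)) := by
  -- The push-forward along a function that is not a.e. measurable would be zero.
  have hm : AEMeasurable (Φ.count B) μ := by
    apply AEMeasurable.of_map_ne_zero
    rw [hΦ.map_count B hB]
    exact IsProbabilityMeasure.ne_zero _
  have := congrArg (fun κ => κ {0}) (hΦ.map_count B hB)
  beta_reduce at this
  rw [Measure.map_apply_of_aemeasurable hm (measurableSet_singleton 0),
    poissonMeasure_singleton] at this
  have h : μ (Φ.count B ⁻¹' {0}) = ENNReal.ofReal (Real.exp (-((ν B).toNNReal : ℝ))) := by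
    simpa using this
  exact h

lemma measure_one_le_count [IsProbabilityMeasure μ] (hΦ : Φ.IsPoisson μ ν) {B : Set E3}
    (hB : MeasurableSet B) :
    μ {ω | 1 ≤ Φ.count B ω} = ENNReal.ofReal (1 - Real.exp (-(ν B).toReal)) := by
  have h : MeasurableSet {ω | 1 ≤ Φ.count B ω} :=
    Φ.measurableSet_one_le_count (measurable_snd hB)
  have e : {ω | 1 ≤ Φ.count B ω} = {ω | Φ.count B ω = 0}ᶜ := by
    ext ω; simp [Nat.one_le_iff_ne_zero]
  have h' : MeasurableSet {ω | Φ.count B ω = 0} := by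
    rw [e] at h; simpa using h.compl
  rw [e, prob_compl_eq_one_sub h', hΦ.measure_count_eq_zero hB,
    ENNReal.ofReal_sub _ (Real.exp_pos _).le, ENNReal.ofReal_one]

/-- The points of a Poisson process on a sphere lie on the sphere. -/
lemma ae_norm_pt [IsProbabilityMeasure μ] {l R : ℝ} (hR : 0 ≤ R)
    (hΦ : Φ.IsPoisson μ (ENNReal.ofReal l • sphereArea R)) :
    ∀ᵐ ω ∂μ, ∀ i < Φ.num ω, ‖Φ.pt i ω‖ = R := by
  have h1 : MeasurableSet {y : E3 | ‖y‖ = R} := measurableSet_eq_fun (by fun_prop) (by fun_prop)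
  have h2 : MeasurableSet {y : E3 | ‖y‖ ≠ R} := h1.compl
  have h3 := hΦ.measure_one_le_count h2
  rw [Measure.smul_apply, sphereArea_compl_sphere hR] at h3
  simp only [smul_zero, ENNReal.toReal_zero, neg_zero, Real.exp_zero, sub_self,
    ENNReal.ofReal_zero] at h3
  filter_upwards [measure_eq_zero_iff_ae_notMem.1 h3] with ω hω i hi
  by_contra hne
  exact hω ((Φ.one_le_count_iff _ ω).2 ⟨i, hi, hne⟩)

/-- The probability that a Poisson process hits a cap. A cap whose height exceeds the radius is
empty, and then the right-hand side is truncated to `0`. -/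
lemma measure_one_le_count_cap [IsProbabilityMeasure μ] {l R h : ℝ} (hl : 0 ≤ l) (h0 : 0 < h)
    (hR : 0 < R) (hΦ : Φ.IsPoisson μ (ENNReal.ofReal l • sphereArea R)) {y : E3} (hy : y ≠ 0) :
    μ {ω | 1 ≤ Φ.count (cap R y h) ω} =
      ENNReal.ofReal (1 - Real.exp (-(2 * Real.pi * l * R * (R - h)))) := by
  rcases le_or_gt h R with hle | hlt
  · have : 0 ≤ R - h := sub_nonneg.2 hle
    rw [hΦ.measure_one_le_count (measurableSet_cap R y h), Measure.smul_apply,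
      sphereArea_cap h0 hle hy, smul_eq_mul, ENNReal.toReal_mul, ENNReal.toReal_ofReal hl,
      ENNReal.toReal_ofReal (by positivity)]
    congr 4
    ring
  · have he : cap R y h = ∅ := by
      ext x
      simp only [cap, Set.mem_ofPred_eq, Set.mem_empty_iff_false, iff_false]
      rintro ⟨hx, hxy⟩
      have h1 := real_inner_le_norm x y
      rw [hx] at h1
      have := (mul_lt_mul_iff_left₀ (norm_pos_iff.2 hy)).2 hlt
      linarith
    have hempty : {ω | 1 ≤ Φ.count (cap R y h) ω} = ∅ := by
      ext ω
      simp [one_le_count_iff, he]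
    rw [hempty, measure_empty, ENNReal.ofReal_of_nonpos]
    rw [sub_nonpos, Real.one_le_exp_iff]
    have : 0 ≤ 2 * Real.pi * l * R * (h - R) := by
      have : 0 ≤ h - R := by linarith
      positivity
    linarith

end PointProcess.IsPoisson

/-- The density proportional to `r * exp (-k π r ^ 2)`, normalized so that `{r | a ≤ r}` has mass
one. -/
def rayleighPDF (k a r : ℝ) : ℝ :=
  2 * k * Real.pi * Real.exp (k * Real.pi * a ^ 2) * (r * Real.exp (-(k * Real.pi * r ^ 2)))

/-- The measure with density `rayleighPDF k a` on `[a, b]`. Its mass is less than one; the rest is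
the probability that there is no point within distance `b`. -/
def rayleighOn (k a b : ℝ) : Measure ℝ :=
  (volume.restrict (Set.Icc a b)).withDensity fun r => ENNReal.ofReal (rayleighPDF k a r)

lemma continuous_rayleighPDF (k a : ℝ) : Continuous (rayleighPDF k a) := by
  unfold rayleighPDF; fun_prop

lemma lintegral_rayleighPDF {k a t : ℝ} (hk : 0 ≤ k) (ha : 0 ≤ a) (hat : a ≤ t) :
    ∫⁻ r in Set.Icc a t, ENNReal.ofReal (rayleighPDF k a r) =
      ENNReal.ofReal (1 - Real.exp (-(k * Real.pi * (t ^ 2 - a ^ 2)))) := by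
  have hd : ∀ r ∈ Set.uIcc a t, HasDerivAt
      (fun r => -Real.exp (-(k * Real.pi * (r ^ 2 - a ^ 2)))) (rayleighPDF k a r) r := by
    intro r _
    have h1 : HasDerivAt (fun r : ℝ => -(k * Real.pi * (r ^ 2 - a ^ 2)))
        (-(k * Real.pi * (2 * r))) r := by
      have := (((hasDerivAt_pow 2 r).sub_const (a ^ 2)).const_mul (k * Real.pi)).fun_neg
      simpa using this
    refine h1.exp.fun_neg.congr_deriv ?_
    have : Real.exp (-(k * Real.pi * (r ^ 2 - a ^ 2))) =
        Real.exp (k * Real.pi * a ^ 2) * Real.exp (-(k * Real.pi * r ^ 2)) := by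
      rw [← Real.exp_add]; congr 1; ring
    rw [this, rayleighPDF]
    ring
  rw [← ofReal_integral_eq_lintegral_ofReal, integral_Icc_eq_integral_Ioc,
    ← intervalIntegral.integral_of_le hat, intervalIntegral.integral_eq_sub_of_hasDerivAt hd
      ((continuous_rayleighPDF k a).intervalIntegrable _ _)]
  · congr 1
    simp
    ring
  · exact (continuous_rayleighPDF k a).integrableOn_Icc
  · refine (ae_restrict_iff' measurableSet_Icc).2 (.of_forall fun r hr => ?_)
    have : 0 ≤ r := ha.trans hr.1
    simp only [Pi.zero_apply, rayleighPDF]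
    positivity

lemma rayleighOn_Iic {k a b : ℝ} (hk : 0 ≤ k) (ha : 0 ≤ a) (t : ℝ) :
    rayleighOn k a b (Set.Iic t) =
      if a ≤ min t b then
        ENNReal.ofReal (1 - Real.exp (-(k * Real.pi * (min t b ^ 2 - a ^ 2)))) else 0 := by
  rw [rayleighOn, withDensity_apply _ measurableSet_Iic,
    Measure.restrict_restrict measurableSet_Iic]
  have : Set.Iic t ∩ Set.Icc a b = Set.Icc a (min t b) := by
    ext r; simp; tauto
  rw [this]
  split_ifs with h
  · exact lintegral_rayleighPDF hk ha h
  · rw [Set.Icc_eq_empty h]; simp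

/-- **The nearest point of a Poisson process on a sphere**: on the event that the process hits the
cap of the points within distance `b` of `y`, the distance from `y` to the nearest point has the
(defective) Rayleigh law on `[a, b]`, where `a` is the distance from `y` to the sphere. -/
lemma PointProcess.IsPoisson.map_dist_nearest {Ω : Type*} [MeasurableSpace Ω] {μ : Measure Ω}
    [IsProbabilityMeasure μ] {Φ : PointProcess Ω} {l R ρ h a b : ℝ} (hl : 0 ≤ l) (hR : 0 < R)
    (hΦ : Φ.IsPoisson μ (ENNReal.ofReal l • sphereArea R)) {y : E3} (hρ : 0 < ρ) (hy : ‖y‖ = ρ)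
    (h0 : 0 < h) (ha : 0 ≤ a) (ha2 : a ^ 2 = (R - ρ) ^ 2) (hab : a ≤ b)
    (hb2 : b ^ 2 = R ^ 2 + ρ ^ 2 - 2 * ρ * h) :
    (μ.restrict {ω | 1 ≤ Φ.count (cap R y h) ω}).map
        (fun ω => dist (Φ.pt (Φ.nearestIdx y ω) ω) y) = rayleighOn (l * (R / ρ)) a b := by
  have hb : 0 ≤ b := ha.trans hab
  have hy0 : y ≠ 0 := by rw [← norm_pos_iff, hy]; exact hρ
  have hmd : Measurable fun ω => dist (Φ.pt (Φ.nearestIdx y ω) ω) y :=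
    (Φ.measurable_pt_index (Φ.measurable_nearestIdx measurable_const)).dist measurable_const
  have hhb : h = (R ^ 2 + ρ ^ 2 - b ^ 2) / (2 * ρ) := by rw [hb2]; field_simp; ring
  refine Measure.ext_of_Iic _ _ fun t => ?_
  rw [Measure.map_apply hmd measurableSet_Iic, Measure.restrict_apply (hmd measurableSet_Iic),
    rayleighOn_Iic (by positivity) ha]
  rcases lt_or_ge t 0 with ht | ht
  · have : (fun ω => dist (Φ.pt (Φ.nearestIdx y ω) ω) y) ⁻¹' Set.Iic t = ∅ := by
      ext ω
      simp only [Set.mem_preimage, Set.mem_Iic, Set.mem_empty_iff_false, iff_false, not_le]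
      exact ht.trans_le dist_nonneg
    rw [this, if_neg (by rw [le_min_iff]; intro h; linarith [h.1])]
    simp
  set s := min t b with hs
  have hs0 : 0 ≤ s := le_min ht hb
  have hsb : s ≤ b := min_le_right _ _
  set h' := (R ^ 2 + ρ ^ 2 - s ^ 2) / (2 * ρ) with hh'
  have hle : h ≤ h' := by
    rw [hhb, hh']
    gcongr
  -- There is a point in the cap and the nearest one is within `t` iff some point is within `s`.
  have hae : ((fun ω => dist (Φ.pt (Φ.nearestIdx y ω) ω) y) ⁻¹' Set.Iic t ∩
      {ω | 1 ≤ Φ.count (cap R y h) ω} : Set Ω) =ᵐ[μ] {ω | 1 ≤ Φ.count (cap R y h') ω} := by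
    filter_upwards [hΦ.ae_norm_pt hR.le] with ω hω
    apply propext
    change (dist (Φ.pt (Φ.nearestIdx y ω) ω) y ≤ t ∧ 1 ≤ Φ.count (cap R y h) ω) ↔
      1 ≤ Φ.count (cap R y h') ω
    rw [one_le_count_iff, one_le_count_iff, hhb, hh']
    constructor
    · rintro ⟨h1, i, hi, h2⟩
      obtain ⟨h3, h4⟩ := Φ.nearestIdx_spec y (Nat.zero_lt_of_lt hi)
      rw [mem_cap_iff_dist_le hρ hb (hω i hi) hy] at h2
      exact ⟨_, h3, (mem_cap_iff_dist_le hρ hs0 (hω _ h3) hy).2 (le_min h1 ((h4 i hi).trans h2))⟩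
    · rintro ⟨i, hi, h2⟩
      obtain ⟨h3, h4⟩ := Φ.nearestIdx_spec y (Nat.zero_lt_of_lt hi)
      rw [mem_cap_iff_dist_le hρ hs0 (hω i hi) hy] at h2
      exact ⟨(h4 i hi).trans (h2.trans (min_le_left _ _)), i, hi,
        (mem_cap_iff_dist_le hρ hb (hω i hi) hy).2 (h2.trans hsb)⟩
  have hexp : 2 * Real.pi * l * R * (R - h') = l * (R / ρ) * Real.pi * (s ^ 2 - a ^ 2) := by
    rw [hh', ha2]
    field_simp
    ring
  rw [measure_congr hae, hΦ.measure_one_le_count_cap hl (h0.trans_le hle) hR hy0, hexp]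
  split_ifs with has
  · rfl
  · rw [ENNReal.ofReal_of_nonpos]
    rw [sub_nonpos, Real.one_le_exp_iff]
    have : 0 ≤ a ^ 2 - s ^ 2 := by nlinarith
    have : 0 ≤ l * (R / ρ) * Real.pi * (a ^ 2 - s ^ 2) := by positivity
    linarith

/-! ### Shadowed-Rician fading with an integer Nakagami parameter -/

/-- Vandermonde's identity for `(M + 1)ₙ / (1)ₙ`, the binomial coefficient `M + n` over `n`. -/
lemma ascPochhammer_ratio (M n : ℕ) :
    (ascPochhammer ℝ n).eval ((M + 1 : ℕ) : ℝ) / (ascPochhammer ℝ n).eval 1 =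
      ∑ k ∈ Finset.range (M + 1), (M.choose k : ℝ) * n.choose k := by
  have h1 : (ascPochhammer ℝ n).eval ((M + 1 : ℕ) : ℝ) = (n ! * (M + n).choose n : ℕ) := by
    rw [← ascPochhammer_eval_cast, ascPochhammer_nat_eq_ascFactorial,
      Nat.ascFactorial_eq_factorial_mul_choose]
  have h2 : (ascPochhammer ℝ n).eval 1 = (n ! : ℝ) := by
    simp [ascPochhammer_eval_one]
  have h3 : (M + n).choose n = ∑ k ∈ Finset.range (M + 1), M.choose k * n.choose k := by
    rw [Nat.choose_symm_add.symm, add_comm M n, Nat.add_choose_eq,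
      Finset.Nat.sum_antidiagonal_eq_sum_range_succ (fun i j => n.choose i * M.choose j)]
    refine Finset.sum_congr rfl fun k hk => ?_
    rw [Nat.choose_symm (Nat.lt_succ_iff.1 (Finset.mem_range.1 hk)), mul_comm]
  have : (n ! : ℝ) ≠ 0 := by positivity
  rw [h1, h2, h3]
  push_cast
  field_simp

lemma hasSum_choose_mul_pow_div_factorial (k : ℕ) (z : ℝ) :
    HasSum (fun n : ℕ => (n.choose k : ℝ) * (z ^ n / (n ! : ℝ)))
      (z ^ k / (k ! : ℝ) * Real.exp z) := by
  have h : HasSum (fun n : ℕ => z ^ n / (n ! : ℝ)) (Real.exp z) := by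
    rw [Real.exp_eq_exp_ℝ]; exact NormedSpace.expSeries_div_hasSum_exp z
  rw [← hasSum_nat_add_iff' k]
  have h0 : ∑ i ∈ Finset.range k, (i.choose k : ℝ) * (z ^ i / (i ! : ℝ)) = 0 :=
    Finset.sum_eq_zero fun i hi => by
      rw [Nat.choose_eq_zero_of_lt (Finset.mem_range.1 hi)]; simp
  rw [h0, sub_zero]
  refine (h.mul_left (z ^ k / (k ! : ℝ))).congr_fun fun n => ?_
  rw [Nat.cast_choose ℝ (Nat.le_add_left k n), Nat.add_sub_cancel, pow_add]
  have h1 : (n ! : ℝ) ≠ 0 := by positivity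
  have h2 : (k ! : ℝ) ≠ 0 := by positivity
  have h3 : ((n + k) ! : ℝ) ≠ 0 := by positivity
  field_simp

/-- **Kummer's transformation** in the terminating case. -/
lemma confluentF_succ_one (M : ℕ) (z : ℝ) :
    confluentF ((M + 1 : ℕ) : ℝ) 1 z =
      Real.exp z * ∑ k ∈ Finset.range (M + 1), (M.choose k : ℝ) * (z ^ k / (k ! : ℝ)) := by
  have h : HasSum (fun n : ℕ => ∑ k ∈ Finset.range (M + 1),
      (M.choose k : ℝ) * ((n.choose k : ℝ) * (z ^ n / (n ! : ℝ))))
      (∑ k ∈ Finset.range (M + 1), (M.choose k : ℝ) * (z ^ k / (k ! : ℝ) * Real.exp z)) :=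
    hasSum_sum fun k _ => (hasSum_choose_mul_pow_div_factorial k z).mul_left _
  rw [confluentF]
  simp_rw [ascPochhammer_ratio, Finset.sum_mul, mul_assoc]
  rw [h.tsum_eq, Finset.mul_sum]
  exact Finset.sum_congr rfl fun k _ => by ring

namespace Params

variable (p : Params)

lemma m_cast_pos : (0 : ℝ) < p.m := by exact_mod_cast p.m_pos

lemma β_pos : 0 < p.β := by have := p.b_pos; unfold β; positivity

lemma c_nonneg : 0 ≤ p.c := by
  have := p.b_pos; have := p.w_nonneg; have := p.m_cast_pos; unfold c; positivity

lemma β_sub_c_pos : 0 < p.β - p.c := by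
  have := p.b_pos; have := p.w_nonneg; have := p.m_cast_pos
  have h : p.β - p.c = p.m / (2 * p.b * p.m + p.w) := by
    unfold β c; field_simp; ring
  rw [h]; positivity

/-- The coefficients are nonnegative multiples of binomial coefficients, since
`(-1) ^ z * (1 - m)_z` is a falling factorial of `m - 1`. -/
lemma ζ_eq (z : ℕ) : p.ζ z = (2 * p.b * p.m / (2 * p.b * p.m + p.w)) ^ p.m *
    (p.β * ((p.m - 1).choose z : ℝ) * p.c ^ z / (z ! : ℝ)) := by
  have h : (ascPochhammer ℝ z).eval (1 - p.m : ℝ) =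
      (-1) ^ z * ((z ! : ℝ) * (p.m - 1).choose z) := by
    have : (1 - p.m : ℝ) = -((p.m - 1 : ℕ) : ℝ) := by
      rw [Nat.cast_sub p.m_pos]; simp
    rw [this, ascPochhammer_eval_neg_eq_descPochhammer, descPochhammer_eval_eq_descFactorial,
      Nat.descFactorial_eq_factorial_mul_choose]
    push_cast
    ring
  have h1 : ((-1 : ℝ) ^ z) * (-1) ^ z = 1 := by rw [← mul_pow]; simp
  have hz : (z ! : ℝ) ≠ 0 := by positivity
  rw [ζ, h]
  congr 1
  calc _ = p.β * (((-1 : ℝ) ^ z) * (-1) ^ z) * ((z ! : ℝ) * (p.m - 1).choose z) * p.c ^ z /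
        (z ! : ℝ) ^ 2 := by ring
    _ = _ := by rw [h1]; field_simp

lemma ζ_nonneg (z : ℕ) : 0 ≤ p.ζ z := by
  have := p.b_pos; have := p.w_nonneg; have := p.m_cast_pos
  have := p.β_pos; have := p.c_nonneg
  rw [ζ_eq]; positivity

/-- The density on `(0, ∞)` of the power of a Shadowed-Rician channel: a mixture of Gamma
densities. -/
def powerPDF (x : ℝ) : ℝ :=
  ∑ z ∈ Finset.range p.m, p.ζ z * (x ^ z * Real.exp (-((p.β - p.c) * x)))

/-- The law of the power of a Shadowed-Rician channel. -/
def powerLaw : Measure ℝ :=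
  (volume.restrict (Set.Ioi 0)).withDensity fun x => ENNReal.ofReal (p.powerPDF x)

lemma continuous_powerPDF : Continuous p.powerPDF := by unfold powerPDF; fun_prop

lemma powerPDF_nonneg {x : ℝ} (hx : 0 ≤ x) : 0 ≤ p.powerPDF x :=
  Finset.sum_nonneg fun z _ => mul_nonneg (p.ζ_nonneg z) (by positivity)

lemma shadowedRicianPDF_eq (x : ℝ) :
    shadowedRicianPDF p.m p.b p.w x = 2 * x * p.powerPDF (x ^ 2) := by
  obtain ⟨M, hM⟩ := Nat.exists_eq_add_of_le' p.m_pos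
  have e : p.w * x ^ 2 / (2 * p.b * (2 * p.b * p.m + p.w)) = p.c * x ^ 2 := by
    rw [c]; ring
  have e2 : -x ^ 2 / (2 * p.b) = -(p.β * x ^ 2) := by rw [β]; ring
  have e3 : x / p.b = 2 * x * p.β := by rw [β]; ring
  have e4 : Real.exp (-((p.β - p.c) * x ^ 2)) =
      Real.exp (-(p.β * x ^ 2)) * Real.exp (p.c * x ^ 2) := by
    rw [← Real.exp_add]; congr 1; ring
  have e5 : confluentF (p.m : ℝ) 1 (p.c * x ^ 2) = Real.exp (p.c * x ^ 2) *
      ∑ k ∈ Finset.range p.m, ((p.m - 1).choose k : ℝ) * ((p.c * x ^ 2) ^ k / (k ! : ℝ)) := by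
    have := confluentF_succ_one M (p.c * x ^ 2)
    rw [hM]
    simpa using this
  rw [shadowedRicianPDF, e, e2, e3, e5, powerPDF, Finset.mul_sum, Finset.mul_sum, Finset.mul_sum]
  refine Finset.sum_congr rfl fun z _ => ?_
  rw [ζ_eq, e4, mul_pow]
  ring

end Params

variable {Ω : Type*} [MeasurableSpace Ω] {μ : Measure Ω}

lemma IsShadowedRicianPower.ae_pos {p : Params} {H : Ω → ℝ}
    (hH : IsShadowedRicianPower μ p.m p.b p.w H) : ∀ᵐ ω ∂μ, 0 < H ω := by
  have hm : Measurable fun ω => Real.sqrt (H ω) := hH.1.sqrt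
  have h : ∀ᵐ x ∂(μ.map fun ω => Real.sqrt (H ω)), 0 < x := by
    rw [hH.2]
    exact (withDensity_absolutelyContinuous _ _).ae_le (ae_restrict_mem measurableSet_Ioi)
  filter_upwards [ae_of_ae_map hm.aemeasurable h] with ω hω using Real.sqrt_pos.1 hω

/-- A Shadowed-Rician amplitude has a square with law `powerLaw`. -/
lemma IsShadowedRicianPower.map_eq {p : Params} {H : Ω → ℝ}
    (hH : IsShadowedRicianPower μ p.m p.b p.w H) : μ.map H = p.powerLaw := by
  have hm : Measurable fun ω => Real.sqrt (H ω) := hH.1.sqrt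
  have hsq : Measurable fun x : ℝ => x ^ 2 := by fun_prop
  have h1 : μ.map H = (μ.map fun ω => Real.sqrt (H ω)).map fun x => x ^ 2 := by
    rw [Measure.map_map hsq hm]
    refine Measure.map_congr ?_
    filter_upwards [hH.ae_pos] with ω hω
    simp [Real.sq_sqrt hω.le]
  have himg : (fun x : ℝ => x ^ 2) '' Set.Ioi 0 = Set.Ioi 0 := by
    ext x
    constructor
    · rintro ⟨y, hy, rfl⟩
      exact pow_pos (Set.mem_Ioi.1 hy) 2
    · intro hx
      exact ⟨Real.sqrt x, Real.sqrt_pos.2 hx, Real.sq_sqrt (le_of_lt hx)⟩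
  have hinj : Set.InjOn (fun x : ℝ => x ^ 2) (Set.Ioi 0) := fun x hx y hy h =>
    (sq_eq_sq₀ (le_of_lt hx) (le_of_lt hy)).1 h
  rw [h1, hH.2]
  ext s hs
  rw [Measure.map_apply hsq hs, withDensity_apply _ (hsq hs), Params.powerLaw,
    withDensity_apply _ hs, ← lintegral_indicator hs, ← lintegral_indicator (hsq hs)]
  have := lintegral_image_eq_lintegral_abs_deriv_mul measurableSet_Ioi
    (fun x _ => (hasDerivAt_pow 2 x).hasDerivWithinAt) hinj
    (s.indicator fun x => ENNReal.ofReal (p.powerPDF x))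
  rw [himg] at this
  rw [this]
  refine setLIntegral_congr_fun measurableSet_Ioi fun x hx => ?_
  have hx0 : (0:ℝ) < x := hx
  by_cases hxs : x ^ 2 ∈ s
  · rw [Set.indicator_of_mem (by exact hxs), Set.indicator_of_mem hxs,
      p.shadowedRicianPDF_eq, ← ENNReal.ofReal_mul (abs_nonneg _), abs_of_nonneg (by positivity)]
    simp
  · rw [Set.indicator_of_notMem (by exact hxs), Set.indicator_of_notMem hxs, mul_zero]

/-! ### Integrals against the power law -/

/-- The tail of a Gamma distribution with integer shape is a partial exponential sum. -/
lemma hasDerivAt_gammaTail (a : ℝ) (z : ℕ) (x : ℝ) :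
    HasDerivAt (fun x => -(Real.exp (-(a * x)) *
        ∑ v ∈ Finset.range (z + 1), (a * x) ^ v / (v ! : ℝ)))
      (a ^ (z + 1) / (z ! : ℝ) * (x ^ z * Real.exp (-(a * x)))) x := by
  have he : HasDerivAt (fun x : ℝ => Real.exp (-(a * x))) (Real.exp (-(a * x)) * (-a)) x := by
    have : HasDerivAt (fun x : ℝ => -(a * x)) (-a) x := by
      simpa using ((hasDerivAt_id x).const_mul a).fun_neg
    exact this.exp
  induction z with
  | zero =>
    refine (he.fun_neg.congr_deriv (by simp; ring)).congr_of_eventuallyEq (.of_forall fun y => ?_)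
    simp
  | succ z ih =>
    have hp : HasDerivAt (fun x : ℝ => (a * x) ^ (z + 1) / ((z + 1)! : ℝ))
        (a ^ (z + 1) * x ^ z / (z ! : ℝ)) x := by
      have h0 : HasDerivAt (fun x : ℝ => a * x) a x := by
        simpa using (hasDerivAt_id x).const_mul a
      refine ((h0.fun_pow (z + 1)).div_const _).congr_deriv ?_
      rw [Nat.factorial_succ]
      push_cast
      have : (z ! : ℝ) ≠ 0 := by positivity
      field_simp
      ring
    refine ((ih.fun_sub (he.fun_mul hp)).congr_deriv ?_).congr_of_eventuallyEq
      (.of_forall fun y => ?_)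
    · rw [Nat.factorial_succ]
      push_cast
      have : (z ! : ℝ) ≠ 0 := by positivity
      field_simp
      ring
    · beta_reduce
      rw [Finset.sum_range_succ _ (z + 1)]
      ring

lemma integral_pow_mul_exp_neg {a : ℝ} (ha : 0 < a) (z : ℕ) (t : ℝ) :
    ∫ x in (0 : ℝ)..t, x ^ z * Real.exp (-(a * x)) =
      (z ! : ℝ) / a ^ (z + 1) *
        (1 - Real.exp (-(a * t)) * ∑ v ∈ Finset.range (z + 1), (a * t) ^ v / (v ! : ℝ)) := by
  have h := intervalIntegral.integral_eq_sub_of_hasDerivAt (a := 0) (b := t)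
    (fun x _ => hasDerivAt_gammaTail a z x) (Continuous.intervalIntegrable (by fun_prop) _ _)
  rw [intervalIntegral.integral_const_mul] at h
  have h0 : ∑ v ∈ Finset.range (z + 1), (a * 0) ^ v / (v ! : ℝ) = 1 := by
    rw [Finset.sum_range_succ']; simp
  rw [h0] at h
  have hz : (z ! : ℝ) ≠ 0 := by positivity
  have h' : ∫ x in (0 : ℝ)..t, x ^ z * Real.exp (-(a * x)) = (z ! : ℝ) / a ^ (z + 1) *
      (a ^ (z + 1) / (z ! : ℝ) * ∫ x in (0 : ℝ)..t, x ^ z * Real.exp (-(a * x))) := by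
    field_simp
  rw [h', h]
  simp
  left
  ring

lemma integrableOn_pow_mul_exp_neg {a : ℝ} (ha : 0 < a) (z : ℕ) :
    IntegrableOn (fun x : ℝ => x ^ z * Real.exp (-(a * x))) (Set.Ioi 0) := by
  have := integrableOn_rpow_mul_exp_neg_mul_rpow (s := z) (p := 1) (b := a)
    (by have : (0:ℝ) ≤ z := by positivity
        linarith) one_pos ha
  simpa using this

lemma integral_Ioi_pow_mul_exp_neg {a : ℝ} (ha : 0 < a) (z : ℕ) :
    ∫ x in Set.Ioi (0 : ℝ), x ^ z * Real.exp (-(a * x)) = Real.Gamma (z + 1) / a ^ (z + 1) := by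
  have h := Real.integral_rpow_mul_exp_neg_mul_Ioi (a := z + 1) (r := a) (by positivity) ha
  have e : ((1 / a) ^ ((z : ℝ) + 1) : ℝ) = (1 / a) ^ (z + 1) := by
    exact_mod_cast Real.rpow_natCast (1 / a) (z + 1)
  simp only [add_sub_cancel_right, Real.rpow_natCast, e] at h
  rw [h, one_div, inv_pow, inv_mul_eq_div]

namespace Params

variable (p : Params)

lemma powerLaw_ae_pos : ∀ᵐ x ∂p.powerLaw, 0 < x :=
  (withDensity_absolutelyContinuous _ _).ae_le (ae_restrict_mem measurableSet_Ioi)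

lemma integral_powerLaw (f : ℝ → ℝ) :
    ∫ x, f x ∂p.powerLaw = ∫ x in Set.Ioi 0, p.powerPDF x * f x := by
  rw [powerLaw, integral_withDensity_eq_integral_toReal_smul
    (by have := p.continuous_powerPDF; fun_prop) (.of_forall fun _ => ENNReal.ofReal_lt_top)]
  refine setIntegral_congr_fun measurableSet_Ioi fun x hx => ?_
  simp only [smul_eq_mul]
  rw [ENNReal.toReal_ofReal (p.powerPDF_nonneg (le_of_lt hx))]

lemma integrable_powerLaw_iff (f : ℝ → ℝ) :
    Integrable f p.powerLaw ↔ IntegrableOn (fun x => p.powerPDF x * f x) (Set.Ioi 0) := by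
  rw [powerLaw, integrable_withDensity_iff_integrable_smul'
    (by have := p.continuous_powerPDF; fun_prop) (.of_forall fun _ => ENNReal.ofReal_lt_top)]
  refine integrable_congr ((ae_restrict_iff' measurableSet_Ioi).2 (.of_forall fun x hx => ?_))
  simp only [smul_eq_mul]
  rw [ENNReal.toReal_ofReal (p.powerPDF_nonneg (le_of_lt hx))]

lemma integrable_id_powerLaw : Integrable (fun x => x) p.powerLaw := by
  rw [integrable_powerLaw_iff]
  simp only [powerPDF, Finset.sum_mul]
  refine integrable_finsetSum _ fun z _ => ?_
  have := (integrableOn_pow_mul_exp_neg p.β_sub_c_pos (z + 1)).const_mul (p.ζ z)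
  refine this.congr (.of_forall fun x => ?_)
  beta_reduce
  ring

/-- The complementary distribution function of the fading power. -/
def powerCCDF (t : ℝ) : ℝ :=
  1 - ∑ z ∈ Finset.range p.m, p.ζ z * Real.Gamma (z + 1) / (p.β - p.c) ^ (z + 1) *
    (1 - Real.exp (-((p.β - p.c) * t)) *
      ∑ v ∈ Finset.range (z + 1), ((p.β - p.c) * t) ^ v / (v ! : ℝ))

lemma powerLaw_real_Ici [IsProbabilityMeasure p.powerLaw] {t : ℝ} (ht : 0 ≤ t) :
    p.powerLaw.real (Set.Ici t) = p.powerCCDF t := by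
  have h1 : p.powerLaw.real (Set.Iio t) = ∫ x in (0 : ℝ)..t, p.powerPDF x := by
    rw [intervalIntegral.integral_of_le ht, integral_Ioc_eq_integral_Ioo, measureReal_def,
      powerLaw, withDensity_apply _ measurableSet_Iio, Measure.restrict_restrict measurableSet_Iio]
    have : Set.Iio t ∩ Set.Ioi 0 = Set.Ioo 0 t := by ext; simp [and_comm]
    rw [this, ← ofReal_integral_eq_lintegral_ofReal, ENNReal.toReal_ofReal]
    · exact setIntegral_nonneg measurableSet_Ioo fun x hx => p.powerPDF_nonneg hx.1.le
    · exact (p.continuous_powerPDF.integrableOn_Icc).mono_set Set.Ioo_subset_Icc_self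
    · exact (ae_restrict_iff' measurableSet_Ioo).2
        (.of_forall fun x hx => p.powerPDF_nonneg hx.1.le)
  have h2 : p.powerLaw.real (Set.Ici t) = 1 - p.powerLaw.real (Set.Iio t) := by
    rw [← Set.compl_Iio, probReal_compl_eq_one_sub measurableSet_Iio]
  rw [h2, h1, powerCCDF]
  congr 1
  simp only [powerPDF]
  rw [intervalIntegral.integral_finsetSum
    fun z _ => Continuous.intervalIntegrable (by fun_prop) _ _]
  refine Finset.sum_congr rfl fun z _ => ?_
  rw [intervalIntegral.integral_const_mul, integral_pow_mul_exp_neg p.β_sub_c_pos,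
    Real.Gamma_nat_eq_factorial]
  ring

lemma integral_exp_neg_mul_powerLaw {s : ℝ} (hs : 0 ≤ s) :
    ∫ x, Real.exp (-(s * x)) ∂p.powerLaw =
      ∑ z ∈ Finset.range p.m, p.ζ z * (Real.Gamma (z + 1) / (p.β - p.c + s) ^ (z + 1)) := by
  have ha : 0 < p.β - p.c + s := add_pos_of_pos_of_nonneg p.β_sub_c_pos hs
  rw [integral_powerLaw]
  have : ∀ x, p.powerPDF x * Real.exp (-(s * x)) =
      ∑ z ∈ Finset.range p.m, p.ζ z * (x ^ z * Real.exp (-((p.β - p.c + s) * x))) := by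
    intro x
    have e : Real.exp (-((p.β - p.c + s) * x)) =
      Real.exp (-((p.β - p.c) * x)) * Real.exp (-(s * x)) := by
      rw [← Real.exp_add]; congr 1; ring
    rw [powerPDF, Finset.sum_mul]
    exact Finset.sum_congr rfl fun z _ => by rw [e]; ring
  simp_rw [this]
  rw [integral_finsetSum _ fun z _ => (integrableOn_pow_mul_exp_neg ha z).const_mul _]
  refine Finset.sum_congr rfl fun z _ => ?_
  rw [integral_const_mul, integral_Ioi_pow_mul_exp_neg ha]

end Params

/-! ### The threshold set by the eavesdropper -/

namespace Params

variable (p : Params)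

lemma G_pos : 0 < p.G := by
  have := p.gTxMain_pos; have := p.gRxMain_pos; have := p.cLight_pos; have := p.fc_pos
  have := Real.pi_pos
  unfold G; positivity

lemma Ge_pos : 0 < p.Ge := by
  have := p.gTxMain_pos; have := p.gTxSide_pos; have := p.gRxMain_pos; have := p.cLight_pos
  have := p.fc_pos; have := Real.pi_pos
  rcases p.Ge_eq with h | h <;> rw [h] <;> positivity

lemma sbar_pos : 0 < p.sbar := by
  have := p.G_pos; have := p.noise_pos; have := p.Ptx_pos
  unfold sbar; positivity

lemma Gbar_pos : 0 < p.Gbar := div_pos p.Ge_pos p.G_pos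

/-- The power `2 ^ γ * (sbar + Gbar * k * r ^ (-α)) - sbar` that the user has to receive for a
secrecy rate `γ`, when the eavesdropper at distance `r` has fading power `k`. -/
def eveThreshold (γ r k : ℝ) : ℝ := (2 : ℝ) ^ γ * (p.sbar + p.Gbar * k * r ^ (-p.α)) - p.sbar

lemma continuous_eveThreshold (γ r : ℝ) : Continuous (p.eveThreshold γ r) := by
  unfold eveThreshold; fun_prop

lemma eveThreshold_nonneg {γ r k : ℝ} (hγ : 0 ≤ γ) (hr : 0 < r) (hk : 0 ≤ k) :
    0 ≤ p.eveThreshold γ r k := by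
  have := p.sbar_pos; have := p.Gbar_pos
  have h1 : (1 : ℝ) ≤ 2 ^ γ := Real.one_le_rpow one_le_two hγ
  have h2 : 0 ≤ p.Gbar * k * r ^ (-p.α) := by positivity
  unfold eveThreshold
  nlinarith

lemma integral_exp_neg_eveThreshold {γ r s : ℝ} (hr : 0 < r) (hs : 0 ≤ s) :
    ∫ k, Real.exp (-(s * p.eveThreshold γ r k)) ∂p.powerLaw = p.laplace γ r s := by
  have := p.Gbar_pos
  have h : ∀ k, Real.exp (-(s * p.eveThreshold γ r k)) =
      Real.exp (-(s * ((2 : ℝ) ^ γ * p.sbar - p.sbar))) *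
        Real.exp (-(s * (2 : ℝ) ^ γ * p.Gbar * r ^ (-p.α) * k)) := by
    intro k
    rw [← Real.exp_add, eveThreshold]
    congr 1
    ring
  simp_rw [h]
  rw [integral_const_mul, p.integral_exp_neg_mul_powerLaw (by positivity), laplace]

lemma ae_eveThreshold_nonneg {γ r : ℝ} (hγ : 0 ≤ γ) (hr : 0 < r) :
    ∀ᵐ k ∂p.powerLaw, 0 ≤ p.eveThreshold γ r k := by
  filter_upwards [p.powerLaw_ae_pos] with k hk using p.eveThreshold_nonneg hγ hr hk.le

/-- The secrecy rate is at least `γ` exactly when the user receives at least the threshold power. -/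
lemma le_rate_sub_rate_iff {γ d e h k : ℝ} (hd : 0 < d) (he : 0 < e) (hh : 0 ≤ h) (hk : 0 ≤ k) :
    γ ≤ Real.logb 2 (1 + p.G * p.Ptx * h * d ^ (-p.α) / p.noise) -
        Real.logb 2 (1 + p.Ge * p.Ptx * k * e ^ (-p.α) / p.noise) ↔
      d ^ p.α * p.eveThreshold γ e k ≤ h := by
  have hG := p.G_pos; have hGe := p.Ge_pos; have hP := p.Ptx_pos; have hN := p.noise_pos
  have hs := p.sbar_pos
  have hA : p.G * p.Ptx * h * d ^ (-p.α) / p.noise = h * d ^ (-p.α) / p.sbar := by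
    unfold sbar; field_simp
  have hB : p.Ge * p.Ptx * k * e ^ (-p.α) / p.noise = p.Gbar * k * e ^ (-p.α) / p.sbar := by
    unfold sbar Gbar; field_simp
  have hGb := p.Gbar_pos
  have hBpos : 0 < 1 + p.Gbar * k * e ^ (-p.α) / p.sbar := by positivity
  have hApos : 0 < 1 + h * d ^ (-p.α) / p.sbar := by positivity
  have hdα : 0 < d ^ p.α := by positivity
  have hγ : γ = Real.logb 2 ((2 : ℝ) ^ γ) := (Real.logb_rpow two_pos (by norm_num)).symm
  have h2 : 0 < (2 : ℝ) ^ γ := by positivity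
  rw [hA, hB, le_sub_iff_add_le]
  nth_rewrite 1 [hγ]
  rw [← Real.logb_mul h2.ne' hBpos.ne', Real.logb_le_logb one_lt_two (by positivity) hApos,
    eveThreshold, Real.rpow_neg hd.le]
  have e1 : (2 : ℝ) ^ γ * (1 + p.Gbar * k * e ^ (-p.α) / p.sbar) =
      (2 : ℝ) ^ γ * (p.sbar + p.Gbar * k * e ^ (-p.α)) / p.sbar := by field_simp
  have e2 : 1 + h * (d ^ p.α)⁻¹ / p.sbar = (p.sbar + h / d ^ p.α) / p.sbar := by field_simp
  rw [e1, e2, div_le_div_iff_of_pos_right hs, ← sub_le_iff_le_add', le_div_iff₀' hdα]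

variable [IsProbabilityMeasure p.powerLaw]

/-- The derivatives of the Laplace transform of the threshold are its exponential moments. -/
lemma iteratedDeriv_laplace {γ r s : ℝ} (hγ : 0 ≤ γ) (hr : 0 < r) (hs : 0 < s) (v : ℕ) :
    iteratedDeriv v (fun s => p.laplace γ r s) s =
      ∫ k, (-p.eveThreshold γ r k) ^ v * Real.exp (-(s * p.eveThreshold γ r k)) ∂p.powerLaw := by
  have hmgf : ∀ t, 0 ≤ t → mgf (fun k => -p.eveThreshold γ r k) p.powerLaw t = p.laplace γ r t := by
    intro t ht
    rw [mgf, ← p.integral_exp_neg_eveThreshold hr ht]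
    simp
  -- `laplace` agrees with the moment generating function only where `0 ≤ s`, but this contains a
  -- neighbourhood of a positive `s`.
  have hev : (fun s => p.laplace γ r s) =ᶠ[nhds s]
      mgf (fun k => -p.eveThreshold γ r k) p.powerLaw := by
    filter_upwards [lt_mem_nhds hs] with t ht using (hmgf t ht.le).symm
  have hcont := p.continuous_eveThreshold γ r
  have hsub : Set.Ici (0 : ℝ) ⊆ integrableExpSet (fun k => -p.eveThreshold γ r k) p.powerLaw := by
    intro t ht
    refine Integrable.of_bound (C := 1) (by fun_prop) ?_
    filter_upwards [p.ae_eveThreshold_nonneg hγ hr] with k hk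
    rw [Real.norm_of_nonneg (Real.exp_pos _).le, Real.exp_le_one_iff]
    have : 0 ≤ t * p.eveThreshold γ r k := mul_nonneg ht hk
    linarith
  have hint : s ∈ interior (integrableExpSet (fun k => -p.eveThreshold γ r k) p.powerLaw) :=
    interior_mono hsub (by rw [interior_Ici]; exact hs)
  rw [hev.iteratedDeriv_eq, iteratedDeriv_mgf hint]
  simp

/-- Averaging the complementary distribution function of the user's fading power over the fading
power of the eavesdropper. -/
lemma integral_powerCCDF_eveThreshold {γ r D : ℝ} (hγ : 0 ≤ γ) (hr : 0 < r) (hD : 0 < D) :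
    ∫ k, p.powerCCDF (D * p.eveThreshold γ r k) ∂p.powerLaw =
      1 - ∑ z ∈ Finset.range p.m, p.ζ z * Real.Gamma (z + 1) / (p.β - p.c) ^ (z + 1) *
        (1 - ∑ v ∈ Finset.range (z + 1), (p.β - p.c) ^ v * D ^ v / (v ! : ℝ) * (-1) ^ v *
          iteratedDeriv v (fun s => p.laplace γ r s) ((p.β - p.c) * D)) := by
  have ha := p.β_sub_c_pos
  have hcont := p.continuous_eveThreshold γ r
  set S := (p.β - p.c) * D with hS
  have hS0 : 0 < S := by positivity
  have hterm : ∀ v : ℕ, Integrable (fun k => Real.exp (-(S * p.eveThreshold γ r k)) *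
      ((S * p.eveThreshold γ r k) ^ v / (v ! : ℝ))) p.powerLaw := by
    intro v
    refine Integrable.of_bound (C := 1) (by fun_prop) ?_
    filter_upwards [p.ae_eveThreshold_nonneg hγ hr] with k hk
    have hx : 0 ≤ S * p.eveThreshold γ r k := by positivity
    rw [Real.norm_of_nonneg (by positivity), Real.exp_neg, inv_mul_le_iff₀ (Real.exp_pos _),
      mul_one]
    exact Real.pow_div_factorial_le_exp _ hx v
  have hI : ∀ v : ℕ, ∫ k, Real.exp (-(S * p.eveThreshold γ r k)) *
      ((S * p.eveThreshold γ r k) ^ v / (v ! : ℝ)) ∂p.powerLaw =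
      (p.β - p.c) ^ v * D ^ v / (v ! : ℝ) * (-1) ^ v *
        iteratedDeriv v (fun s => p.laplace γ r s) S := by
    intro v
    rw [p.iteratedDeriv_laplace hγ hr hS0, ← integral_const_mul]
    congr 1
    funext k
    have h1 : ((-1 : ℝ) ^ v) * (-p.eveThreshold γ r k) ^ v = p.eveThreshold γ r k ^ v := by
      rw [← mul_pow]; simp
    calc _ = (p.β - p.c) ^ v * D ^ v / (v ! : ℝ) * (p.eveThreshold γ r k ^ v) *
          Real.exp (-(S * p.eveThreshold γ r k)) := by rw [mul_pow, hS, mul_pow]; ring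
      _ = _ := by rw [← h1]; ring
  have he : ∀ k, p.powerCCDF (D * p.eveThreshold γ r k) =
      1 - ∑ z ∈ Finset.range p.m, p.ζ z * Real.Gamma (z + 1) / (p.β - p.c) ^ (z + 1) *
        (1 - ∑ v ∈ Finset.range (z + 1), Real.exp (-(S * p.eveThreshold γ r k)) *
          ((S * p.eveThreshold γ r k) ^ v / (v ! : ℝ))) := by
    intro k
    simp only [powerCCDF, hS, Finset.mul_sum, mul_assoc]
  simp_rw [he]
  have hz : ∀ z : ℕ, Integrable (fun k => (1 - ∑ v ∈ Finset.range (z + 1),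
      Real.exp (-(S * p.eveThreshold γ r k)) * ((S * p.eveThreshold γ r k) ^ v / (v ! : ℝ))))
      p.powerLaw := fun z => (integrable_const _).sub (integrable_finsetSum _ fun v _ => hterm v)
  rw [integral_sub (integrable_const _) (integrable_finsetSum _ fun z _ => (hz z).const_mul _),
    integral_finsetSum _ fun z _ => (hz z).const_mul _]
  simp only [integral_const, probReal_univ, smul_eq_mul, mul_one]
  congr 1
  refine Finset.sum_congr rfl fun z _ => ?_
  rw [integral_const_mul,
    integral_sub (integrable_const _) (integrable_finsetSum _ fun v _ => hterm v),
    integral_finsetSum _ fun v _ => hterm v]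
  simp only [integral_const, probReal_univ, smul_eq_mul, mul_one, hI]

end Params

/-! ### Joint laws by conditioning on an independent variable -/

section Fiber

variable {Ω α β γ δ : Type*} [MeasurableSpace Ω] [MeasurableSpace α] [MeasurableSpace β]
  [MeasurableSpace γ] [MeasurableSpace δ] {μ : Measure Ω} [IsProbabilityMeasure μ]
  {X : Ω → α} {Y : Ω → β}

/-- Let `X` and `Y` be independent. If for almost every value `x` of `X` in `A` the variable
`g (x, Y)`, on the event `(x, Y) ∈ K`, has the law `κ`, which does not depend on `x`, then on the
event `X ∈ A`, `(X, Y) ∈ K` the variable `g (X, Y)` is independent of every function of `X`. -/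
lemma map_restrict_prod_of_fiber (hX : Measurable X) (hY : Measurable Y) (hXY : IndepFun X Y μ)
    {A : Set α} (hA : MeasurableSet A) {K : Set (α × β)} (hK : MeasurableSet K)
    {Z : α → γ} (hZ : Measurable Z) {g : α × β → δ} (hg : Measurable g)
    {κ : Measure δ} [IsFiniteMeasure κ]
    (hfib : ∀ᵐ ω ∂μ, X ω ∈ A → ∀ T, MeasurableSet T →
      μ {ω' | (X ω, Y ω') ∈ K ∧ g (X ω, Y ω') ∈ T} = κ T) :
    (μ.restrict {ω | X ω ∈ A ∧ (X ω, Y ω) ∈ K}).map (fun ω => (Z (X ω), g (X ω, Y ω))) =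
      ((μ.restrict (X ⁻¹' A)).map (fun ω => Z (X ω))).prod κ := by
  have hXYm : Measurable fun ω => (X ω, Y ω) := hX.prodMk hY
  symm
  refine Measure.prod_eq fun S T hS hT => ?_
  have hZX : Measurable fun ω => Z (X ω) := hZ.comp hX
  have hpair : Measurable fun ω => (Z (X ω), g (X ω, Y ω)) := hZX.prodMk (hg.comp hXYm)
  set M : Set (α × β) := {q | q.1 ∈ A ∩ Z ⁻¹' S ∧ q ∈ K ∩ g ⁻¹' T} with hM
  have hMm : MeasurableSet M := (measurable_fst (hA.inter (hZ hS))).inter (hK.inter (hg hT))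
  have e1 : (μ.restrict {ω | X ω ∈ A ∧ (X ω, Y ω) ∈ K}).map
      (fun ω => (Z (X ω), g (X ω, Y ω))) (S ×ˢ T) = μ.map (fun ω => (X ω, Y ω)) M := by
    rw [Measure.map_apply hpair (hS.prod hT), Measure.map_apply hXYm hMm,
      Measure.restrict_apply (hpair (hS.prod hT))]
    congr 1
    ext ω
    simp [hM]
    tauto
  rw [e1, (indepFun_iff_map_prod_eq_prod_map_map hX.aemeasurable hY.aemeasurable).1 hXY,
    Measure.prod_apply hMm, lintegral_map (measurable_measure_prodMk_left hMm) hX,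
    Measure.map_apply hZX hS, Measure.restrict_apply (hZX hS)]
  have e2 : ∀ᵐ ω ∂μ, μ.map Y (Prod.mk (X ω) ⁻¹' M) =
      (X ⁻¹' (A ∩ Z ⁻¹' S)).indicator (fun _ => κ T) ω := by
    filter_upwards [hfib] with ω hω
    rw [Measure.map_apply hY (measurable_prodMk_left hMm)]
    by_cases h : X ω ∈ A ∩ Z ⁻¹' S
    · rw [Set.indicator_of_mem (by exact h), ← hω h.1 T hT]
      congr 1
      ext ω'
      simp only [hM, Set.mem_preimage, Set.mem_ofPred_eq, Set.mem_inter_iff]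
      simp only [Set.mem_inter_iff, Set.mem_preimage] at h
      tauto
    · rw [Set.indicator_of_notMem (by exact h)]
      have : Y ⁻¹' (Prod.mk (X ω) ⁻¹' M) = ∅ := by
        ext ω'
        simp only [hM, Set.mem_preimage, Set.mem_ofPred_eq, Set.mem_empty_iff_false, iff_false]
        exact fun h' => h h'.1
      rw [this, measure_empty]
  rw [lintegral_congr_ae e2, lintegral_indicator_const (hX (hA.inter (hZ hS))), mul_comm]
  congr 2
  ext ω
  simp [and_comm]

/-- An entry, chosen by `X`, of an independent family of identically distributed variables is
independent of `X`. -/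
lemma map_restrict_prod_of_index {Y : Ω → ℕ → ℝ} (hX : Measurable X) (hY : Measurable Y)
    (hXY : IndepFun X Y μ) {A : Set α} (hA : MeasurableSet A) {Z : α → γ} (hZ : Measurable Z)
    {I : α → ℕ} (hI : Measurable I) {κ : Measure ℝ} [IsFiniteMeasure κ]
    (hκ : ∀ i, μ.map (fun ω => Y ω i) = κ) :
    (μ.restrict (X ⁻¹' A)).map (fun ω => (Z (X ω), Y ω (I (X ω)))) =
      ((μ.restrict (X ⁻¹' A)).map (fun ω => Z (X ω))).prod κ := by
  have hg : Measurable fun q : α × (ℕ → ℝ) => q.2 (I q.1) := by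
    have : Measurable fun q : ℕ × (ℕ → ℝ) => q.2 q.1 :=
      measurable_from_prod_countable_right fun i => measurable_pi_apply i
    exact this.comp ((hI.comp measurable_fst).prodMk measurable_snd)
  have h := map_restrict_prod_of_fiber hX hY hXY hA MeasurableSet.univ hZ hg (κ := κ)
    (.of_forall fun ω _ T hT => by
      have hYi : Measurable fun ω' => Y ω' (I (X ω)) := (measurable_pi_apply _).comp hY
      rw [← hκ (I (X ω)), Measure.map_apply hYi hT]
      simp only [Set.mem_univ, true_and]
      rfl)
  simp only [Set.mem_univ, and_true] at h
  exact h

end Fiber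

/-! ### Configurations of points -/

/-- A configuration: a number of points and a sequence of locations. -/
abbrev Config : Type := ℕ × (ℕ → E3)

namespace PointProcess

variable {Ω : Type*} [MeasurableSpace Ω]

/-- The process as a random configuration. -/
def config (Φ : PointProcess Ω) (ω : Ω) : Config := (Φ.num ω, fun i => Φ.pt i ω)

lemma measurable_config_sigma (Φ : PointProcess Ω) : Measurable[Φ.sigma] Φ.config := by
  have h1 : Measurable[Φ.sigma] Φ.num := (comap_measurable Φ.num).mono le_sup_left le_rfl
  have h2 : ∀ i, Measurable[Φ.sigma] (Φ.pt i) := fun i =>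
    (comap_measurable (Φ.pt i)).mono
      ((le_iSup (fun i => MeasurableSpace.comap (Φ.pt i) inferInstance) i).trans
        le_sup_right) le_rfl
  exact Measurable.prodMk h1 (@measurable_pi_lambda Ω ℕ (fun _ => E3) Φ.sigma _ _ h2)

lemma sigma_le (Φ : PointProcess Ω) : Φ.sigma ≤ ‹MeasurableSpace Ω› :=
  sup_le Φ.measurable_num.comap_le (iSup_le fun i => (Φ.measurable_pt i).comap_le)

lemma measurable_config (Φ : PointProcess Ω) : Measurable Φ.config :=
  Φ.measurable_config_sigma.mono Φ.sigma_le le_rfl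

/-- The canonical process on the space of configurations, evaluated at a measurable function of the
sample. -/
def ofConfig {f : Ω → Config} (hf : Measurable f) : PointProcess Ω where
  num ω := (f ω).1
  pt i ω := (f ω).2 i
  measurable_num := measurable_fst.comp hf
  measurable_pt i := (measurable_pi_apply i).comp (measurable_snd.comp hf)

/-- The canonical process on the space of configurations. -/
abbrev canonical : PointProcess Config := ofConfig measurable_id

end PointProcess

/-! ### The joint law of distances and fading -/

namespace Params

variable (p : Params)

lemma RS_pos : 0 < p.RS := p.RE_pos.trans p.RE_lt_RS

lemma he_pos : 0 < p.he :=
  lt_of_lt_of_le (div_pos (pow_pos p.RE_pos 2) p.RS_pos) p.le_he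

lemma Rmin_pos : 0 < p.Rmin := sub_pos.2 p.RE_lt_RS

lemma lamT_pos : 0 < p.lamT := mul_pos p.lam_pos (div_pos p.RS_pos p.RE_pos)

lemma lamET_pos : 0 < p.lamET := mul_pos p.lamE_pos (div_pos p.RE_pos p.RS_pos)

lemma norm_typicalUser : ‖p.typicalUser‖ = p.RE := by
  rw [typicalUser, EuclideanSpace.norm_eq]
  simp [Fin.sum_univ_succ, Real.sqrt_sq_eq_abs, abs_of_pos p.RE_pos]

lemma Rmin_sq_lt_U : p.Rmin ^ 2 < p.RS ^ 2 - p.RE ^ 2 - 2 * p.RE * p.hs := by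
  have := mul_pos p.RE_pos (sub_pos.2 p.hs_lt)
  unfold Rmin
  nlinarith

lemma Rmin_sq_lt_E : p.Rmin ^ 2 < p.RS ^ 2 + p.RE ^ 2 - 2 * p.RS * p.he := by
  have := mul_pos p.RS_pos (sub_pos.2 p.he_lt)
  unfold Rmin
  nlinarith

lemma RmaxU_sq : p.RmaxU ^ 2 = p.RS ^ 2 - p.RE ^ 2 - 2 * p.RE * p.hs :=
  Real.sq_sqrt ((sq_nonneg _).trans p.Rmin_sq_lt_U.le)

lemma RmaxE_sq : p.RmaxE ^ 2 = p.RS ^ 2 + p.RE ^ 2 - 2 * p.RS * p.he :=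
  Real.sq_sqrt ((sq_nonneg _).trans p.Rmin_sq_lt_E.le)

lemma Rmin_lt_RmaxU : p.Rmin < p.RmaxU := Real.lt_sqrt_of_sq_lt p.Rmin_sq_lt_U

lemma Rmin_lt_RmaxE : p.Rmin < p.RmaxE := Real.lt_sqrt_of_sq_lt p.Rmin_sq_lt_E

/-- The serving satellite of a configuration of satellites. -/
def satOf (x : Config) : E3 :=
  PointProcess.canonical.pt (PointProcess.canonical.nearestIdx p.typicalUser x) x

/-- The index of the eavesdropper nearest to the serving satellite. -/
def eveIdxOf (q : Config × Config) : ℕ := PointProcess.canonical.nearestIdx (p.satOf q.1) q.2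

lemma measurable_nearestIdx_typicalUser :
    Measurable fun x : Config => PointProcess.canonical.nearestIdx p.typicalUser x :=
  PointProcess.canonical.measurable_nearestIdx measurable_const

lemma measurable_satOf : Measurable p.satOf :=
  PointProcess.canonical.measurable_pt_index p.measurable_nearestIdx_typicalUser

lemma measurable_eveIdxOf : Measurable p.eveIdxOf :=
  (PointProcess.ofConfig (measurable_snd (α := Config) (β := Config))).measurable_nearestIdx
    (p.measurable_satOf.comp measurable_fst)

/-- Some satellite of the configuration is visible. -/
def servedOf : Set Config := {x | 1 ≤ PointProcess.canonical.count p.capSat x}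

/-- Some eavesdropper of the second configuration is in the footprint of the serving satellite of
the first. -/
def eveOf : Set (Config × Config) :=
  {q | 1 ≤ PointProcess.canonical.count (p.capEve (p.satOf q.1)) q.2}

lemma measurableSet_servedOf : MeasurableSet p.servedOf :=
  PointProcess.canonical.measurableSet_one_le_count
    (measurable_snd (measurableSet_cap p.RS p.typicalUser (p.RE + p.hs)))

lemma measurableSet_eveOf : MeasurableSet p.eveOf := by
  refine (PointProcess.ofConfig
    (measurable_snd (α := Config) (β := Config))).measurableSet_one_le_count
    (B := fun q => p.capEve (p.satOf q.1)) ?_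
  have : Measurable fun q : (Config × Config) × E3 => (p.satOf q.1.1, q.2) :=
    (p.measurable_satOf.comp (measurable_fst.comp measurable_fst)).prodMk measurable_snd
  exact this (measurableSet_mem_cap p.RE p.he)

/-- The distance from the serving satellite to the nearest eavesdropper. -/
def distEveOf (q : Config × Config) : ℝ :=
  dist (p.satOf q.1) (PointProcess.canonical.pt (p.eveIdxOf q) q.2)

lemma measurable_distEveOf : Measurable p.distEveOf :=
  (p.measurable_satOf.comp measurable_fst).dist
    ((PointProcess.ofConfig (measurable_snd (α := Config) (β := Config))).measurable_pt_index
      p.measurable_eveIdxOf)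

end Params

namespace Network

variable {p : Params} {Ω : Type*} [MeasurableSpace Ω] {μ : Measure Ω} (N : Network p μ)

/-- The fading family of the user. -/
def fadingSeqU (ω : Ω) (i : ℕ) : ℝ := N.HU i ω

/-- The fading family of the eavesdroppers. -/
def fadingSeqE (ω : Ω) (n : ℕ) : ℝ := N.HE n ω

/-- The configurations of satellites and of eavesdroppers. -/
def configs (ω : Ω) : Config × Config := (N.sats.config ω, N.eves.config ω)

/-- The configurations together with the fading family of the user. -/
def configsU (ω : Ω) : (Config × Config) × (ℕ → ℝ) := (N.configs ω, N.fadingSeqU ω)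

lemma measurable_fadingSeqU : Measurable N.fadingSeqU :=
  measurable_pi_lambda _ fun i => (N.HU_law i).1

lemma measurable_fadingSeqE : Measurable N.fadingSeqE :=
  measurable_pi_lambda _ fun n => (N.HE_law n).1

lemma measurable_configs : Measurable N.configs :=
  N.sats.measurable_config.prodMk N.eves.measurable_config

lemma measurable_configsU : Measurable N.configsU :=
  N.measurable_configs.prodMk N.measurable_fadingSeqU

/-- The five independent sources of randomness. -/
abbrev sources : Fin 5 → MeasurableSpace Ω :=
  ![N.sats.sigma, N.users.sigma, N.eves.sigma,
    ⨆ i, MeasurableSpace.comap (N.HU i) inferInstance,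
    ⨆ n, MeasurableSpace.comap (N.HE n) inferInstance]

lemma sources_le (i : Fin 5) : N.sources i ≤ ‹MeasurableSpace Ω› := by
  fin_cases i
  · exact N.sats.sigma_le
  · exact N.users.sigma_le
  · exact N.eves.sigma_le
  · exact iSup_le fun i => (N.HU_law i).1.comap_le
  · exact iSup_le fun i => (N.HE_law i).1.comap_le

/-- Variables that depend on disjoint sets of sources are independent. -/
lemma indepFun_of_sources {α β : Type*} [MeasurableSpace α] [MeasurableSpace β] {X : Ω → α}
    {Y : Ω → β} {S T : Set (Fin 5)} (hST : Disjoint S T)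
    (hX : Measurable[⨆ i ∈ S, N.sources i] X) (hY : Measurable[⨆ i ∈ T, N.sources i] Y) :
    IndepFun X Y μ := by
  rw [IndepFun_iff_Indep]
  exact indep_of_indep_of_le_left (indep_of_indep_of_le_right
    (indep_iSup_of_disjoint N.sources_le N.indep hST) hY.comap_le) hX.comap_le

lemma measurable_source_sats {S : Set (Fin 5)} (h : 0 ∈ S) :
    Measurable[⨆ i ∈ S, N.sources i] N.sats.config :=
  N.sats.measurable_config_sigma.mono (le_iSup₂_of_le 0 h le_rfl) le_rfl

lemma measurable_source_eves {S : Set (Fin 5)} (h : 2 ∈ S) :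
    Measurable[⨆ i ∈ S, N.sources i] N.eves.config :=
  N.eves.measurable_config_sigma.mono (le_iSup₂_of_le 2 h le_rfl) le_rfl

lemma measurable_source_fadingSeqU {S : Set (Fin 5)} (h : 3 ∈ S) :
    Measurable[⨆ i ∈ S, N.sources i] N.fadingSeqU := by
  have h1 : (⨆ i, MeasurableSpace.comap (N.HU i) inferInstance) ≤ ⨆ i ∈ S, N.sources i :=
    le_iSup₂_of_le 3 h le_rfl
  exact @measurable_pi_lambda Ω ℕ (fun _ => ℝ) (⨆ i ∈ S, N.sources i) _ _ fun i =>
    (comap_measurable (N.HU i)).mono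
    ((le_iSup (fun i => MeasurableSpace.comap (N.HU i) inferInstance) i).trans h1) le_rfl

lemma measurable_source_fadingSeqE {S : Set (Fin 5)} (h : 4 ∈ S) :
    Measurable[⨆ i ∈ S, N.sources i] N.fadingSeqE := by
  have h1 : (⨆ i, MeasurableSpace.comap (N.HE i) inferInstance) ≤ ⨆ i ∈ S, N.sources i :=
    le_iSup₂_of_le 4 h le_rfl
  exact @measurable_pi_lambda Ω ℕ (fun _ => ℝ) (⨆ i ∈ S, N.sources i) _ _ fun i =>
    (comap_measurable (N.HE i)).mono
    ((le_iSup (fun i => MeasurableSpace.comap (N.HE i) inferInstance) i).trans h1) le_rfl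

lemma indepFun_sats_eves : IndepFun N.sats.config N.eves.config μ :=
  N.indepFun_of_sources (S := {0}) (T := {2}) (by simp) (N.measurable_source_sats (by simp))
    (N.measurable_source_eves (by simp))

lemma indepFun_configs_fadingSeqU : IndepFun N.configs N.fadingSeqU μ :=
  N.indepFun_of_sources (S := {0, 2}) (T := {3}) (by simp)
    (Measurable.prodMk (N.measurable_source_sats (by simp)) (N.measurable_source_eves (by simp)))
    (N.measurable_source_fadingSeqU (by simp))

lemma indepFun_configsU_fadingSeqE : IndepFun N.configsU N.fadingSeqE μ :=
  N.indepFun_of_sources (S := {0, 2, 3}) (T := {4}) (by simp)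
    (Measurable.prodMk (Measurable.prodMk (N.measurable_source_sats (by simp))
      (N.measurable_source_eves (by simp))) (N.measurable_source_fadingSeqU (by simp)))
    (N.measurable_source_fadingSeqE (by simp))

lemma servedNoEve_eq : N.servedNoEve = N.configs ⁻¹' (Prod.fst ⁻¹' p.servedOf ∩ p.eveOfᶜ) := by
  ext ω
  refine and_congr_right fun _ => ?_
  change _ ↔ ¬ (1 ≤ N.eves.count (p.capEve (N.servingSat ω)) ω)
  omega

lemma measurableSet_served : MeasurableSet N.served :=
  N.sats.measurable_config p.measurableSet_servedOf

lemma measurableSet_servedEve : MeasurableSet N.servedEve :=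
  N.measurable_configs ((measurable_fst p.measurableSet_servedOf).inter p.measurableSet_eveOf)

lemma measurableSet_servedNoEve : MeasurableSet N.servedNoEve := by
  rw [servedNoEve_eq]
  exact N.measurable_configs
    ((measurable_fst p.measurableSet_servedOf).inter p.measurableSet_eveOf.compl)

variable [IsProbabilityMeasure μ]

lemma isProbabilityMeasure_powerLaw (N : Network p μ) : IsProbabilityMeasure p.powerLaw := by
  rw [← (N.HU_law 0).map_eq]
  exact Measure.isProbabilityMeasure_map (N.HU_law 0).1.aemeasurable

lemma ae_norm_servingSat : ∀ᵐ ω ∂μ, ω ∈ N.served → ‖N.servingSat ω‖ = p.RS := by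
  filter_upwards [N.sats_poisson.ae_norm_pt p.RS_pos.le] with ω hω hs
  obtain ⟨i, hi, -⟩ := (N.sats.one_le_count_iff _ ω).1 hs
  exact hω _ (N.sats.nearestIdx_spec p.typicalUser (Nat.zero_lt_of_lt hi)).1

lemma map_distUser : (μ.restrict N.served).map N.distUser = rayleighOn p.lamT p.Rmin p.RmaxU := by
  refine N.sats_poisson.map_dist_nearest p.lam_pos.le p.RS_pos p.RE_pos p.norm_typicalUser
    (add_pos_of_pos_of_nonneg p.RE_pos p.hs_nonneg) p.Rmin_pos.le rfl p.Rmin_lt_RmaxU.le ?_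
  rw [p.RmaxU_sq]
  ring

/-- The law of the distance from a satellite at `x` to the nearest eavesdropper, on the event that
there is an eavesdropper in the footprint of `x`. -/
lemma map_dist_nearest_eve {x : E3} (hx : ‖x‖ = p.RS) :
    (μ.restrict {ω | 1 ≤ N.eves.count (p.capEve x) ω}).map
        (fun ω => dist x (N.eves.pt (N.eves.nearestIdx x ω) ω)) =
      rayleighOn p.lamET p.Rmin p.RmaxE := by
  simp_rw [dist_comm x]
  refine N.eves_poisson.map_dist_nearest p.lamE_pos.le p.RE_pos p.RS_pos hx p.he_pos p.Rmin_pos.le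
    ?_ p.Rmin_lt_RmaxE.le ?_
  · rw [Params.Rmin]; ring
  · rw [p.RmaxE_sq]; ring

end Network

/-! ### The conditional laws of the network -/

lemma rayleighOn_univ {k a b : ℝ} (hk : 0 ≤ k) (ha : 0 ≤ a) (hab : a ≤ b) :
    rayleighOn k a b Set.univ =
      ENNReal.ofReal (1 - Real.exp (-(k * Real.pi * (b ^ 2 - a ^ 2)))) := by
  rw [rayleighOn, withDensity_apply _ MeasurableSet.univ, Measure.restrict_univ,
    lintegral_rayleighPDF hk ha hab]

instance (k a b : ℝ) : IsFiniteMeasure (rayleighOn k a b) := by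
  refine isFiniteMeasure_withDensity_ofReal ?_
  exact ((continuous_rayleighPDF k a).integrableOn_Icc).2

namespace Params

variable (p : Params)

/-- The law of the distance to the serving satellite, given that the user is served. -/
def distULaw : Measure ℝ :=
  (volume.restrict (Set.Icc p.Rmin p.RmaxU)).withDensity fun r => ENNReal.ofReal (p.densU r)

/-- The law of the distance to the nearest eavesdropper, given that the footprint contains one. -/
def distELaw : Measure ℝ :=
  (volume.restrict (Set.Icc p.Rmin p.RmaxE)).withDensity fun r => ENNReal.ofReal (p.densE r)

lemma voidU_lt_one : p.voidU < 1 := by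
  rw [voidU, Real.exp_lt_one_iff, neg_lt_zero]
  have h := sub_pos.2 p.Rmin_sq_lt_U
  rw [← p.RmaxU_sq] at h
  exact mul_pos (mul_pos p.lamT_pos Real.pi_pos) h

lemma voidE_lt_one : p.voidE < 1 := by
  rw [voidE, Real.exp_lt_one_iff, neg_lt_zero]
  have h := sub_pos.2 p.Rmin_sq_lt_E
  rw [← p.RmaxE_sq] at h
  exact mul_pos (mul_pos p.lamET_pos Real.pi_pos) h

lemma densU_eq (r : ℝ) : p.densU r = (1 - p.voidU)⁻¹ * rayleighPDF p.lamT p.Rmin r := by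
  rw [densU, rayleighPDF]; ring

lemma densE_eq (r : ℝ) : p.densE r = (1 - p.voidE)⁻¹ * rayleighPDF p.lamET p.Rmin r := by
  rw [densE, rayleighPDF]; ring

lemma continuous_densU : Continuous p.densU := by unfold densU; fun_prop

lemma continuous_densE : Continuous p.densE := by unfold densE; fun_prop

lemma rayleighOn_eq_distULaw :
    rayleighOn p.lamT p.Rmin p.RmaxU = ENNReal.ofReal (1 - p.voidU) • p.distULaw := by
  have h := sub_pos.2 p.voidU_lt_one
  have hm : Measurable fun r => ENNReal.ofReal (p.densU r) :=
    p.continuous_densU.measurable.ennreal_ofReal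
  rw [distULaw, rayleighOn, ← withDensity_smul _ hm]
  congr 1
  funext r
  rw [Pi.smul_apply, smul_eq_mul, ← ENNReal.ofReal_mul h.le, densU_eq, mul_inv_cancel_left₀ h.ne']

lemma rayleighOn_eq_distELaw :
    rayleighOn p.lamET p.Rmin p.RmaxE = ENNReal.ofReal (1 - p.voidE) • p.distELaw := by
  have h := sub_pos.2 p.voidE_lt_one
  have hm : Measurable fun r => ENNReal.ofReal (p.densE r) :=
    p.continuous_densE.measurable.ennreal_ofReal
  rw [distELaw, rayleighOn, ← withDensity_smul _ hm]
  congr 1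
  funext r
  rw [Pi.smul_apply, smul_eq_mul, ← ENNReal.ofReal_mul h.le, densE_eq, mul_inv_cancel_left₀ h.ne']

instance : IsProbabilityMeasure p.distULaw where
  measure_univ := by
    have h := sub_pos.2 p.voidU_lt_one
    have h1 := rayleighOn_univ p.lamT_pos.le p.Rmin_pos.le p.Rmin_lt_RmaxU.le
    rw [rayleighOn_eq_distULaw, Measure.smul_apply, smul_eq_mul] at h1
    change _ = ENNReal.ofReal (1 - p.voidU) at h1
    have h0 : ENNReal.ofReal (1 - p.voidU) ≠ 0 := by simpa using h
    rwa [ENNReal.mul_eq_left h0 ENNReal.ofReal_ne_top] at h1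

instance : IsProbabilityMeasure p.distELaw where
  measure_univ := by
    have h := sub_pos.2 p.voidE_lt_one
    have h1 := rayleighOn_univ p.lamET_pos.le p.Rmin_pos.le p.Rmin_lt_RmaxE.le
    rw [rayleighOn_eq_distELaw, Measure.smul_apply, smul_eq_mul] at h1
    change _ = ENNReal.ofReal (1 - p.voidE) at h1
    have h0 : ENNReal.ofReal (1 - p.voidE) ≠ 0 := by simpa using h
    rwa [ENNReal.mul_eq_left h0 ENNReal.ofReal_ne_top] at h1

lemma densU_nonneg {r : ℝ} (hr : 0 ≤ r) : 0 ≤ p.densU r := by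
  have h := sub_pos.2 p.voidU_lt_one
  have := p.lamT_pos
  unfold densU; positivity

lemma densE_nonneg {r : ℝ} (hr : 0 ≤ r) : 0 ≤ p.densE r := by
  have h := sub_pos.2 p.voidE_lt_one
  have := p.lamET_pos
  unfold densE; positivity

lemma distULaw_ae_mem : ∀ᵐ r ∂p.distULaw, r ∈ Set.Icc p.Rmin p.RmaxU :=
  (withDensity_absolutelyContinuous _ _).ae_le (ae_restrict_mem measurableSet_Icc)

lemma distELaw_ae_mem : ∀ᵐ r ∂p.distELaw, r ∈ Set.Icc p.Rmin p.RmaxE :=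
  (withDensity_absolutelyContinuous _ _).ae_le (ae_restrict_mem measurableSet_Icc)

lemma integral_withDensity_Icc {a b : ℝ} (hab : a ≤ b) {f g : ℝ → ℝ} (hf : Continuous f)
    (h0 : ∀ r ∈ Set.Icc a b, 0 ≤ f r) :
    ∫ r, g r ∂((volume.restrict (Set.Icc a b)).withDensity fun r => ENNReal.ofReal (f r)) =
      ∫ r in a..b, g r * f r := by
  rw [integral_withDensity_eq_integral_toReal_smul hf.measurable.ennreal_ofReal
    (.of_forall fun _ => ENNReal.ofReal_lt_top), intervalIntegral.integral_of_le hab,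
    ← integral_Icc_eq_integral_Ioc]
  refine setIntegral_congr_fun measurableSet_Icc fun r hr => ?_
  rw [ENNReal.toReal_ofReal (h0 r hr), smul_eq_mul, mul_comm]

lemma integral_distULaw (g : ℝ → ℝ) :
    ∫ r, g r ∂p.distULaw = ∫ r in p.Rmin..p.RmaxU, g r * p.densU r :=
  integral_withDensity_Icc p.Rmin_lt_RmaxU.le p.continuous_densU
    fun _ hr => p.densU_nonneg (p.Rmin_pos.le.trans hr.1)

lemma integral_distELaw (g : ℝ → ℝ) :
    ∫ r, g r ∂p.distELaw = ∫ r in p.Rmin..p.RmaxE, g r * p.densE r :=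
  integral_withDensity_Icc p.Rmin_lt_RmaxE.le p.continuous_densE
    fun _ hr => p.densE_nonneg (p.Rmin_pos.le.trans hr.1)

end Params

/-- A law on an event that is `c` times a probability measure determines the probability of the
event and the conditional law. -/
lemma cond_map_eq {Ω α : Type*} [MeasurableSpace Ω] [MeasurableSpace α] {μ : Measure Ω} {s : Set Ω}
    {f : Ω → α} (hf : Measurable f) {c : ENNReal} (hc : c ≠ 0)
    (hc' : c ≠ ⊤) {κ : Measure α} [IsProbabilityMeasure κ] (h : (μ.restrict s).map f = c • κ) :
    μ s = c ∧ (cond μ s).map f = κ := by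
  have h1 : μ s = c := by
    have := congrArg (fun m => m Set.univ) h
    simpa [Measure.map_apply hf MeasurableSet.univ] using this
  refine ⟨h1, ?_⟩
  rw [ProbabilityTheory.cond, Measure.map_smul, h, h1, smul_smul, ENNReal.inv_mul_cancel hc hc',
    one_smul]

namespace Network

variable {p : Params} {Ω : Type*} [MeasurableSpace Ω] {μ : Measure Ω} (N : Network p μ)

lemma measurable_servingSat : Measurable N.servingSat :=
  N.sats.measurable_pt_index (N.sats.measurable_nearestIdx measurable_const)

lemma measurable_distUser : Measurable N.distUser :=
  N.measurable_servingSat.dist measurable_const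

lemma measurable_distEve : Measurable N.distEve :=
  N.measurable_servingSat.dist
    (N.eves.measurable_pt_index (N.eves.measurable_nearestIdx N.measurable_servingSat))

lemma measurable_fadingUser : Measurable N.fadingUser := by
  have : Measurable fun q : ℕ × Ω => N.HU q.1 q.2 :=
    measurable_from_prod_countable_right fun i => (N.HU_law i).1
  exact this.comp ((N.sats.measurable_nearestIdx measurable_const).prodMk measurable_id)

lemma measurable_fadingEve : Measurable N.fadingEve := by
  have : Measurable fun q : ℕ × Ω => N.HE q.1 q.2 :=
    measurable_from_prod_countable_right fun i => (N.HE_law i).1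
  exact this.comp ((N.eves.measurable_nearestIdx N.measurable_servingSat).prodMk measurable_id)

lemma map_fadingSeqU (i : ℕ) : μ.map (fun ω => N.fadingSeqU ω i) = p.powerLaw :=
  (N.HU_law i).map_eq

lemma map_fadingSeqE (n : ℕ) : μ.map (fun ω => N.fadingSeqE ω n) = p.powerLaw :=
  (N.HE_law n).map_eq

variable [IsProbabilityMeasure μ]

/-- Conditioning on the satellites: the eavesdropper process seen from the serving satellite has the
same law wherever the satellite is. -/
lemma map_distUser_distEve :
    (μ.restrict N.servedEve).map (fun ω => (N.distUser ω, N.distEve ω)) =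
      (rayleighOn p.lamT p.Rmin p.RmaxU).prod (rayleighOn p.lamET p.Rmin p.RmaxE) := by
  rw [← N.map_distUser]
  refine map_restrict_prod_of_fiber N.sats.measurable_config N.eves.measurable_config
    N.indepFun_sats_eves p.measurableSet_servedOf p.measurableSet_eveOf
    (Z := fun x => dist (p.satOf x) p.typicalUser) (p.measurable_satOf.dist measurable_const)
    p.measurable_distEveOf ?_
  filter_upwards [N.ae_norm_servingSat] with ω hω hA T hT
  have hm : Measurable fun ω' =>
      dist (N.servingSat ω) (N.eves.pt (N.eves.nearestIdx (N.servingSat ω) ω') ω') :=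
    measurable_const.dist
      (N.eves.measurable_pt_index (N.eves.measurable_nearestIdx measurable_const))
  rw [← N.map_dist_nearest_eve (hω hA), Measure.map_apply hm hT, Measure.restrict_apply (hm hT),
    Set.inter_comm]
  rfl

/-- An empty footprint is independent of the satellites. -/
lemma map_distUser_noEve :
    (μ.restrict N.servedNoEve).map N.distUser =
      ENNReal.ofReal p.voidE • rayleighOn p.lamT p.Rmin p.RmaxU := by
  -- The second variable is trivial: only the probability of its event matters.
  have hκ : IsFiniteMeasure (ENNReal.ofReal p.voidE • Measure.dirac ()) :=
    Measure.smul_finite _ ENNReal.ofReal_ne_top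
  have hset : {ω | N.sats.config ω ∈ p.servedOf ∧
      (N.sats.config ω, N.eves.config ω) ∈ p.eveOfᶜ} = N.servedNoEve := N.servedNoEve_eq.symm
  have key := map_restrict_prod_of_fiber N.sats.measurable_config N.eves.measurable_config
    N.indepFun_sats_eves p.measurableSet_servedOf p.measurableSet_eveOf.compl
    (Z := fun x => dist (p.satOf x) p.typicalUser) (p.measurable_satOf.dist measurable_const)
    (g := fun _ => ()) measurable_const (κ := ENNReal.ofReal p.voidE • Measure.dirac ()) (by
      filter_upwards [N.ae_norm_servingSat] with ω hω hA T hT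
      have hm : Measurable fun ω' =>
          dist (N.servingSat ω) (N.eves.pt (N.eves.nearestIdx (N.servingSat ω) ω') ω') :=
        measurable_const.dist
          (N.eves.measurable_pt_index (N.eves.measurable_nearestIdx measurable_const))
      have h1 : μ {ω' | 1 ≤ N.eves.count (p.capEve (N.servingSat ω)) ω'} =
          ENNReal.ofReal (1 - p.voidE) := by
        have := congrArg (fun m => m Set.univ) (N.map_dist_nearest_eve (hω hA))
        rw [rayleighOn_univ p.lamET_pos.le p.Rmin_pos.le p.Rmin_lt_RmaxE.le,
          Measure.map_apply hm MeasurableSet.univ] at this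
        simpa [Params.voidE] using this
      have h2 : μ {ω' | 1 ≤ N.eves.count (p.capEve (N.servingSat ω)) ω'}ᶜ =
          ENNReal.ofReal p.voidE := by
        rw [prob_compl_eq_one_sub (N.eves.measurableSet_one_le_count
          (B := fun _ => p.capEve (N.servingSat ω))
          (measurable_snd (measurableSet_cap _ _ _))), h1, ← ENNReal.ofReal_one,
          ← ENNReal.ofReal_sub _ (sub_nonneg.2 p.voidE_lt_one.le), sub_sub_cancel]
      rw [Measure.smul_apply, Measure.dirac_apply' _ hT, smul_eq_mul, ← h2]
      by_cases hmem : () ∈ T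
      · simp only [hmem, Set.indicator_of_mem, Pi.one_apply, mul_one, and_true]
        rfl
      · simp [hmem])
  rw [hset] at key
  have key2 := congrArg (fun m => m.map Prod.fst) key
  have hd : Measurable fun ω => (N.distUser ω, ()) := N.measurable_distUser.prodMk measurable_const
  have e : (fun ω => (dist (p.satOf (N.sats.config ω)) p.typicalUser, ())) =
    fun ω => (N.distUser ω, ()) := rfl
  rw [e, Measure.map_map measurable_fst hd, Measure.map_fst_prod] at key2
  rw [← N.map_distUser]
  have e2 : (Prod.fst ∘ fun ω => (N.distUser ω, ())) = N.distUser := rfl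
  rw [e2] at key2
  rw [key2]
  congr 1
  simp

/-- The joint law of the distances and the fading powers when the footprint contains an
eavesdropper. -/
lemma cond_map_servedEve :
    μ N.servedEve = ENNReal.ofReal (1 - p.voidU) * ENNReal.ofReal (1 - p.voidE) ∧
    (cond μ N.servedEve).map
        (fun ω => (((N.distUser ω, N.distEve ω), N.fadingUser ω), N.fadingEve ω)) =
      ((p.distULaw.prod p.distELaw).prod p.powerLaw).prod p.powerLaw := by
  have hν := N.isProbabilityMeasure_powerLaw
  have hA : MeasurableSet (Prod.fst ⁻¹' p.servedOf ∩ p.eveOf : Set (Config × Config)) :=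
    (measurable_fst p.measurableSet_servedOf).inter p.measurableSet_eveOf
  have hI : Measurable fun q : Config × Config =>
      PointProcess.canonical.nearestIdx p.typicalUser q.1 :=
    p.measurable_nearestIdx_typicalUser.comp measurable_fst
  have hZ : Measurable fun q : Config × Config =>
      (dist (p.satOf q.1) p.typicalUser, p.distEveOf q) :=
    ((p.measurable_satOf.comp measurable_fst).dist measurable_const).prodMk p.measurable_distEveOf
  have hg : Measurable fun q : (Config × Config) × (ℕ → ℝ) =>
      q.2 (PointProcess.canonical.nearestIdx p.typicalUser q.1.1) := by
    have : Measurable fun q : ℕ × (ℕ → ℝ) => q.2 q.1 :=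
      measurable_from_prod_countable_right fun i => measurable_pi_apply i
    exact this.comp ((hI.comp measurable_fst).prodMk measurable_snd)
  have h1 : (μ.restrict N.servedEve).map (fun ω => ((N.distUser ω, N.distEve ω), N.fadingUser ω)) =
      ((μ.restrict N.servedEve).map (fun ω => (N.distUser ω, N.distEve ω))).prod p.powerLaw :=
    map_restrict_prod_of_index N.measurable_configs N.measurable_fadingSeqU
      N.indepFun_configs_fadingSeqU hA hZ hI N.map_fadingSeqU
  have h2 : (μ.restrict N.servedEve).map
        (fun ω => (((N.distUser ω, N.distEve ω), N.fadingUser ω), N.fadingEve ω)) =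
      ((μ.restrict N.servedEve).map
        (fun ω => ((N.distUser ω, N.distEve ω), N.fadingUser ω))).prod p.powerLaw :=
    map_restrict_prod_of_index N.measurable_configsU N.measurable_fadingSeqE
      N.indepFun_configsU_fadingSeqE (measurable_fst hA)
      ((hZ.comp measurable_fst).prodMk hg) (p.measurable_eveIdxOf.comp measurable_fst)
      N.map_fadingSeqE
  have hU := sub_pos.2 p.voidU_lt_one
  have hE := sub_pos.2 p.voidE_lt_one
  refine cond_map_eq (((N.measurable_distUser.prodMk N.measurable_distEve).prodMk
    N.measurable_fadingUser).prodMk N.measurable_fadingEve)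
    (mul_ne_zero (by simpa using hU) (by simpa using hE))
    (ENNReal.mul_ne_top ENNReal.ofReal_ne_top ENNReal.ofReal_ne_top) ?_
  rw [h2, h1, N.map_distUser_distEve, p.rayleighOn_eq_distULaw, p.rayleighOn_eq_distELaw,
    Measure.prod_smul_left, Measure.prod_smul_right, Measure.prod_smul_left, Measure.prod_smul_left,
    Measure.prod_smul_left, Measure.prod_smul_left, smul_smul]

/-- The joint law of the distance and the fading power of the user when the footprint contains no
eavesdropper. -/
lemma cond_map_servedNoEve :
    μ N.servedNoEve = ENNReal.ofReal p.voidE * ENNReal.ofReal (1 - p.voidU) ∧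
    (cond μ N.servedNoEve).map (fun ω => (N.distUser ω, N.fadingUser ω)) =
      p.distULaw.prod p.powerLaw := by
  have hν := N.isProbabilityMeasure_powerLaw
  have hA : MeasurableSet (Prod.fst ⁻¹' p.servedOf ∩ p.eveOfᶜ : Set (Config × Config)) :=
    (measurable_fst p.measurableSet_servedOf).inter p.measurableSet_eveOf.compl
  have h1 := map_restrict_prod_of_index N.measurable_configs N.measurable_fadingSeqU
    N.indepFun_configs_fadingSeqU hA (Z := fun q => dist (p.satOf q.1) p.typicalUser)
    ((p.measurable_satOf.comp measurable_fst).dist measurable_const)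
    (p.measurable_nearestIdx_typicalUser.comp measurable_fst) N.map_fadingSeqU
  rw [← N.servedNoEve_eq] at h1
  have h2 : (μ.restrict N.servedNoEve).map (fun ω => (N.distUser ω, N.fadingUser ω)) =
    ((μ.restrict N.servedNoEve).map N.distUser).prod p.powerLaw := h1
  have hU := sub_pos.2 p.voidU_lt_one
  have hE : 0 < p.voidE := Real.exp_pos _
  refine cond_map_eq (N.measurable_distUser.prodMk N.measurable_fadingUser)
    (mul_ne_zero (by simpa using hE) (by simpa using hU))
    (ENNReal.mul_ne_top ENNReal.ofReal_ne_top ENNReal.ofReal_ne_top) ?_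
  rw [h2, N.map_distUser_noEve, p.rayleighOn_eq_distULaw, smul_smul, Measure.prod_smul_left]

lemma cond_map_served :
    μ N.served = ENNReal.ofReal (1 - p.voidU) ∧ (cond μ N.served).map N.distUser = p.distULaw := by
  have hU := sub_pos.2 p.voidU_lt_one
  refine cond_map_eq N.measurable_distUser (by simpa using hU) ENNReal.ofReal_ne_top ?_
  rw [N.map_distUser, p.rayleighOn_eq_distULaw]

end Network

/-! ### The rates -/

lemma real_prod_eq_integral {α β : Type*} [MeasurableSpace α] [MeasurableSpace β] {κ : Measure α}
    {ν : Measure β} [IsFiniteMeasure κ] [IsFiniteMeasure ν] {M : Set (α × β)}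
    (hM : MeasurableSet M) : (κ.prod ν).real M = ∫ x, ν.real (Prod.mk x ⁻¹' M) ∂κ := by
  rw [measureReal_def, Measure.prod_apply hM]
  exact (integral_toReal (measurable_measure_prodMk_left hM).aemeasurable
    (.of_forall fun _ => measure_lt_top _ _)).symm

lemma real_prod_le_snd {α : Type*} [MeasurableSpace α] {κ : Measure α} {ν : Measure ℝ}
    [IsFiniteMeasure κ] [IsFiniteMeasure ν] {t : α → ℝ} (ht : Measurable t) :
    (κ.prod ν).real {q | t q.1 ≤ q.2} = ∫ x, ν.real (Set.Ici (t x)) ∂κ :=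
  real_prod_eq_integral (measurableSet_le (ht.comp measurable_fst) measurable_snd)

lemma real_prod_le_fst {α : Type*} [MeasurableSpace α] {κ : Measure α} {ν : Measure ℝ}
    [IsFiniteMeasure κ] [IsFiniteMeasure ν] {t : α → ℝ} (ht : Measurable t) :
    (ν.prod κ).real {q | t q.2 ≤ q.1} = ∫ x, ν.real (Set.Ici (t x)) ∂κ := by
  have hM : MeasurableSet {q : ℝ × α | t q.2 ≤ q.1} :=
    measurableSet_le (ht.comp measurable_snd) measurable_fst
  rw [← real_prod_le_snd ht, ← Measure.prod_swap, measureReal_def, measureReal_def,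
    Measure.map_apply measurable_swap hM]
  rfl

/-- The probability that a variable of law `ν` exceeds a random threshold. -/
lemma real_prod_prod_le {α β : Type*} [MeasurableSpace α] [MeasurableSpace β] {κ : Measure α}
    {κ' : Measure β} {ν : Measure ℝ} [IsProbabilityMeasure κ] [IsProbabilityMeasure κ']
    [IsProbabilityMeasure ν] {t : (α × β) × ℝ → ℝ} (ht : Measurable t) :
    ((κ.prod κ').prod (ν.prod ν)).real {q | t (q.1, q.2.2) ≤ q.2.1} =
      ∫ y, ∫ x, ∫ k, ν.real (Set.Ici (t ((x, y), k))) ∂ν ∂κ ∂κ' := by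
  have hM : MeasurableSet {q : (α × β) × (ℝ × ℝ) | t (q.1, q.2.2) ≤ q.2.1} :=
    measurableSet_le (ht.comp (measurable_fst.prodMk (measurable_snd.comp measurable_snd)))
      (measurable_fst.comp measurable_snd)
  have hmeas : Measurable fun x : α × β => (ν.prod ν).real (Prod.mk x ⁻¹'
      {q : (α × β) × (ℝ × ℝ) | t (q.1, q.2.2) ≤ q.2.1}) :=
    (measurable_measure_prodMk_left hM).ennreal_toReal
  rw [real_prod_eq_integral hM, integral_prod_symm _
    (Integrable.of_bound (C := 1) hmeas.aestronglyMeasurable (.of_forall fun x => by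
      rw [Real.norm_of_nonneg measureReal_nonneg]; exact measureReal_le_one))]
  congr 1
  funext y
  congr 1
  funext x
  exact real_prod_le_fst (t := fun k => t ((x, y), k)) (ht.comp measurable_prodMk_left)

namespace Params

variable (p : Params)

/-- Without an eavesdropper the threshold is the one of an eavesdropper with fading power `0`, at an
arbitrary distance. -/
lemma ccdfNoEve_eq (γ : ℝ) : p.ccdfNoEve γ =
    ∫ d, p.powerCCDF (d ^ p.α * p.eveThreshold γ 1 0) ∂p.distULaw := by
  rw [integral_distULaw, ccdfNoEve]
  congr 1
  funext d
  have e : d ^ p.α * p.eveThreshold γ 1 0 = ((2 : ℝ) ^ γ - 1) * p.sbar * d ^ p.α := by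
    rw [eveThreshold]; ring
  simp only [powerCCDF, e, mul_pow, mul_assoc]

lemma measurable_userThreshold (γ : ℝ) : Measurable fun q : (ℝ × ℝ) × ℝ =>
    q.1.1 ^ p.α * p.eveThreshold γ q.1.2 q.2 := by
  unfold eveThreshold; fun_prop

variable [IsProbabilityMeasure p.powerLaw]

lemma real_prod_noEve {γ : ℝ} (hγ : 0 ≤ γ) :
    (p.distULaw.prod p.powerLaw).real {q | q.1 ^ p.α * p.eveThreshold γ 1 0 ≤ q.2} =
      p.ccdfNoEve γ := by
  rw [real_prod_le_snd (t := fun d => d ^ p.α * p.eveThreshold γ 1 0) (by fun_prop), ccdfNoEve_eq]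
  refine integral_congr_ae ?_
  filter_upwards [p.distULaw_ae_mem] with d hd
  have hd0 : 0 < d := p.Rmin_pos.trans_le hd.1
  have := p.eveThreshold_nonneg hγ one_pos le_rfl
  rw [p.powerLaw_real_Ici (by positivity)]

lemma real_prod_eve {γ : ℝ} (hγ : 0 ≤ γ) :
    ((p.distULaw.prod p.distELaw).prod (p.powerLaw.prod p.powerLaw)).real
      {q | q.1.1 ^ p.α * p.eveThreshold γ q.1.2 q.2.2 ≤ q.2.1} = p.ccdfEve γ := by
  rw [real_prod_prod_le (p.measurable_userThreshold γ), integral_distELaw, ccdfEve]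
  refine intervalIntegral.integral_congr fun e he => ?_
  rw [Set.uIcc_of_le p.Rmin_lt_RmaxE.le] at he
  have he0 : 0 < e := p.Rmin_pos.trans_le he.1
  rw [integral_distULaw, ← intervalIntegral.integral_mul_const]
  refine intervalIntegral.integral_congr fun d hd => ?_
  rw [Set.uIcc_of_le p.Rmin_lt_RmaxU.le] at hd
  have hd0 : 0 < d := p.Rmin_pos.trans_le hd.1
  rw [← p.integral_powerCCDF_eveThreshold hγ he0 (Real.rpow_pos_of_pos hd0 _)]
  congr 2
  refine integral_congr_ae ?_
  filter_upwards [p.ae_eveThreshold_nonneg hγ he0] with k hk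
  rw [p.powerLaw_real_Ici (by positivity)]

end Params

namespace Network

variable {p : Params} {Ω : Type*} [MeasurableSpace Ω] {μ : Measure Ω} (N : Network p μ)

lemma ae_fading_pos : ∀ᵐ ω ∂μ, 0 < N.fadingUser ω ∧ 0 < N.fadingEve ω := by
  filter_upwards [ae_all_iff.2 fun i => (N.HU_law i).ae_pos,
    ae_all_iff.2 fun n => (N.HE_law n).ae_pos] with ω h1 h2 using ⟨h1 _, h2 _⟩

lemma served_eq_union : N.served = N.servedNoEve ∪ N.servedEve := by
  ext ω
  change _ ↔ (_ ∧ _) ∨ (_ ∧ _)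
  rw [← and_or_left, and_iff_left]
  omega

lemma measurable_secrecyRate : Measurable N.secrecyRate := by
  classical
  have h1 := N.measurable_distUser
  have h2 := N.measurable_distEve
  have h3 := N.measurable_fadingUser
  have h4 := N.measurable_fadingEve
  have hU : Measurable N.rateUser := by
    unfold rateUser Real.logb; fun_prop
  have hE : Measurable N.rateEve := by
    have hset : MeasurableSet {ω | 1 ≤ N.eves.count (p.capEve (N.servingSat ω)) ω} :=
      N.measurable_configs p.measurableSet_eveOf
    unfold rateEve Real.logb
    exact Measurable.ite hset (by fun_prop) measurable_const
  unfold secrecyRate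
  exact Measurable.ite N.measurableSet_served ((hU.sub hE).max measurable_const) measurable_const

lemma secrecyRate_nonneg (ω : Ω) : 0 ≤ N.secrecyRate ω := by
  rw [secrecyRate]; split_ifs; exacts [le_max_right _ _, le_rfl]

lemma setOf_le_secrecyRate {γ : ℝ} (hγ : 0 < γ) : {ω | γ ≤ N.secrecyRate ω} = N.exceeds γ := by
  ext ω
  simp only [Set.mem_ofPred_eq, secrecyRate, exceeds]
  split_ifs with h
  · simp [h, hγ.not_ge]
  · simp [h, hγ]

variable [IsProbabilityMeasure μ]

lemma ae_distUser_mem : ∀ᵐ ω ∂μ, ω ∈ N.served → N.distUser ω ∈ Set.Icc p.Rmin p.RmaxU := by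
  refine (ae_restrict_iff' N.measurableSet_served).1
    (ae_of_ae_map N.measurable_distUser.aemeasurable ?_)
  rw [N.map_distUser]
  exact (withDensity_absolutelyContinuous _ _).ae_le (ae_restrict_mem measurableSet_Icc)

lemma cond_map_distEve : (cond μ N.servedEve).map N.distEve = p.distELaw := by
  have hν := N.isProbabilityMeasure_powerLaw
  have h := congrArg (fun m => ((m.map Prod.fst).map Prod.fst).map Prod.snd) N.cond_map_servedEve.2
  have hm := (N.measurable_distUser.prodMk N.measurable_distEve).prodMk N.measurable_fadingUser
  rw [Measure.map_map measurable_fst (hm.prodMk N.measurable_fadingEve)] at h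
  simp only [Measure.map_fst_prod, Measure.map_snd_prod, measure_univ, one_smul] at h
  rw [Measure.map_map measurable_fst, Measure.map_map measurable_snd] at h
  · exact h
  · exact N.measurable_distUser.prodMk N.measurable_distEve
  · exact hm

lemma cond_map_fadingEve : (cond μ N.servedEve).map N.fadingEve = p.powerLaw := by
  have hν := N.isProbabilityMeasure_powerLaw
  have h := congrArg (fun m => m.map Prod.snd) N.cond_map_servedEve.2
  rw [Measure.map_map measurable_snd (((N.measurable_distUser.prodMk N.measurable_distEve).prodMk
    N.measurable_fadingUser).prodMk N.measurable_fadingEve), Measure.map_snd_prod, measure_univ,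
    one_smul] at h
  exact h

lemma measureReal_servedEve : μ.real N.servedEve = (1 - p.voidU) * (1 - p.voidE) := by
  rw [measureReal_def, N.cond_map_servedEve.1, ENNReal.toReal_mul,
    ENNReal.toReal_ofReal (sub_nonneg.2 p.voidU_lt_one.le),
    ENNReal.toReal_ofReal (sub_nonneg.2 p.voidE_lt_one.le)]

lemma measureReal_servedNoEve : μ.real N.servedNoEve = (1 - p.voidU) * p.voidE := by
  rw [measureReal_def, N.cond_map_servedNoEve.1, ENNReal.toReal_mul,
    ENNReal.toReal_ofReal (sub_nonneg.2 p.voidU_lt_one.le),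
    ENNReal.toReal_ofReal (by unfold Params.voidE; positivity), mul_comm]

lemma cond_real_exceeds_noEve {γ : ℝ} (hγ : 0 ≤ γ) :
    (cond μ N.servedNoEve).real (N.exceeds γ) = p.ccdfNoEve γ := by
  have hν := N.isProbabilityMeasure_powerLaw
  have hM : MeasurableSet {q : ℝ × ℝ | q.1 ^ p.α * p.eveThreshold γ 1 0 ≤ q.2} :=
    measurableSet_le (by fun_prop) (by fun_prop)
  rw [← p.real_prod_noEve hγ, ← N.cond_map_servedNoEve.2, measureReal_def, measureReal_def,
    Measure.map_apply (N.measurable_distUser.prodMk N.measurable_fadingUser) hM]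
  congr 1
  refine measure_congr ?_
  have hac : cond μ N.servedNoEve ≪ μ := cond_absolutelyContinuous
  filter_upwards [ae_cond_mem N.measurableSet_servedNoEve, hac.ae_le N.ae_fading_pos,
    hac.ae_le N.ae_distUser_mem] with ω hω hH hd
  have hd0 : 0 < N.distUser ω := p.Rmin_pos.trans_le (hd hω.1).1
  apply propext
  change (ω ∈ N.served ∧ γ ≤ N.rateUser ω - N.rateEve ω) ↔
    N.distUser ω ^ p.α * p.eveThreshold γ 1 0 ≤ N.fadingUser ω
  -- No eavesdropper is the same as one that receives the power `0`.
  have hr : N.rateEve ω = Real.logb 2 (1 + p.Ge * p.Ptx * 0 * 1 ^ (-p.α) / p.noise) := by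
    rw [rateEve, if_neg (by rw [hω.2]; omega)]
    simp
  rw [hr, rateUser, p.le_rate_sub_rate_iff hd0 one_pos hH.1.le le_rfl]
  exact and_iff_right hω.1

lemma cond_real_exceeds_eve {γ : ℝ} (hγ : 0 ≤ γ) :
    (cond μ N.servedEve).real (N.exceeds γ) = p.ccdfEve γ := by
  have hν := N.isProbabilityMeasure_powerLaw
  have hM : MeasurableSet
      {q : (ℝ × ℝ) × (ℝ × ℝ) | q.1.1 ^ p.α * p.eveThreshold γ q.1.2 q.2.2 ≤ q.2.1} :=
    measurableSet_le ((p.measurable_userThreshold γ).comp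
      (measurable_fst.prodMk (measurable_snd.comp measurable_snd)))
      (measurable_fst.comp measurable_snd)
  have hjoint := ((N.measurable_distUser.prodMk N.measurable_distEve).prodMk
    N.measurable_fadingUser).prodMk N.measurable_fadingEve
  have hassoc := (measurePreserving_prodAssoc (p.distULaw.prod p.distELaw) p.powerLaw p.powerLaw)
  rw [← p.real_prod_eve hγ, ← hassoc.map_eq, ← N.cond_map_servedEve.2,
    measureReal_def, measureReal_def, Measure.map_map hassoc.measurable hjoint,
    Measure.map_apply (hassoc.measurable.comp hjoint) hM]
  congr 1
  refine measure_congr ?_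
  have hac : cond μ N.servedEve ≪ μ := cond_absolutelyContinuous
  have hde : ∀ᵐ ω ∂(cond μ N.servedEve), N.distEve ω ∈ Set.Icc p.Rmin p.RmaxE := by
    refine ae_of_ae_map N.measurable_distEve.aemeasurable ?_
    rw [N.cond_map_distEve]
    exact p.distELaw_ae_mem
  filter_upwards [ae_cond_mem N.measurableSet_servedEve, hac.ae_le N.ae_fading_pos,
    hac.ae_le N.ae_distUser_mem, hde] with ω hω hH hd he
  have hd0 : 0 < N.distUser ω := p.Rmin_pos.trans_le (hd hω.1).1
  have he0 : 0 < N.distEve ω := p.Rmin_pos.trans_le he.1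
  apply propext
  change (ω ∈ N.served ∧ γ ≤ N.rateUser ω - N.rateEve ω) ↔
    N.distUser ω ^ p.α * p.eveThreshold γ (N.distEve ω) (N.fadingEve ω) ≤ N.fadingUser ω
  rw [rateEve, if_pos hω.2, rateUser, p.le_rate_sub_rate_iff hd0 he0 hH.1.le hH.2.le]
  exact and_iff_right hω.1

lemma measureReal_exceeds {γ : ℝ} (hγ : 0 ≤ γ) : μ.real (N.exceeds γ) = p.ccdf γ := by
  have h1 : N.exceeds γ \ N.servedEve = N.exceeds γ ∩ N.servedNoEve := by
    ext ω
    have : N.exceeds γ ω → N.served ω := fun h => h.1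
    have h2 : N.served ω ↔ N.servedNoEve ω ∨ N.servedEve ω := by
      have := N.served_eq_union
      exact (Set.ext_iff.1 this ω)
    have h3 : N.servedNoEve ω → ¬ N.servedEve ω := fun h h' => by
      have := h.2; have := h'.2; omega
    change (N.exceeds γ ω ∧ ¬ N.servedEve ω) ↔ (N.exceeds γ ω ∧ N.servedNoEve ω)
    tauto
  have h2 : ∀ s : Set Ω, MeasurableSet s → μ.real (N.exceeds γ ∩ s) =
      μ.real s * (cond μ s).real (N.exceeds γ) := by
    intro s hs
    rw [measureReal_def, measureReal_def, measureReal_def, Set.inter_comm, ← cond_mul_eq_inter hs,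
      ENNReal.toReal_mul, mul_comm]
  rw [← measureReal_inter_add_sdiff (μ := μ) (s := N.exceeds γ) N.measurableSet_servedEve, h1,
    h2 _ N.measurableSet_servedEve, h2 _ N.measurableSet_servedNoEve, N.measureReal_servedEve,
    N.measureReal_servedNoEve, N.cond_real_exceeds_eve hγ, N.cond_real_exceeds_noEve hγ,
    Params.ccdf]
  ring

lemma integrable_fadingUser : Integrable N.fadingUser μ := by
  have hν := N.isProbabilityMeasure_powerLaw
  have h := map_restrict_prod_of_index N.sats.measurable_config N.measurable_fadingSeqU
    (N.indepFun_configs_fadingSeqU.comp measurable_fst measurable_id) MeasurableSet.univ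
    (Z := fun _ => ()) measurable_const p.measurable_nearestIdx_typicalUser N.map_fadingSeqU
  have h' := congrArg (fun m => m.map Prod.snd) h
  have e : (fun ω => ((), N.fadingSeqU ω (PointProcess.canonical.nearestIdx p.typicalUser
    (N.sats.config ω)))) = fun ω => ((), N.fadingUser ω) := rfl
  rw [e, Set.preimage_univ, Measure.restrict_univ, Measure.map_map measurable_snd
    (measurable_const.prodMk N.measurable_fadingUser), Measure.map_snd_prod,
    Measure.map_apply measurable_const MeasurableSet.univ, Set.preimage_univ, measure_univ,
    one_smul] at h'
  have h2 : μ.map N.fadingUser = p.powerLaw := h'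
  have h3 := p.integrable_id_powerLaw
  rw [← h2] at h3
  exact h3.comp_measurable N.measurable_fadingUser

/-- The secrecy rate is dominated by a multiple of the fading power of the user. -/
lemma integrable_secrecyRate : Integrable N.secrecyRate μ := by
  have hG := p.G_pos; have hGe := p.Ge_pos; have hP := p.Ptx_pos; have hN := p.noise_pos
  obtain ⟨B, hB⟩ := isCompact_Icc.exists_bound_of_continuousOn (s := Set.Icc p.Rmin p.RmaxU)
    (f := fun d : ℝ => d ^ (-p.α)) (fun d hd => (Real.continuousAt_rpow_const d (-p.α)
      (.inl (p.Rmin_pos.trans_le hd.1).ne')).continuousWithinAt)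
  have hlog : 0 < Real.log 2 := Real.log_pos one_lt_two
  have hB0 : 0 ≤ B := (norm_nonneg _).trans (hB p.Rmin ⟨le_rfl, p.Rmin_lt_RmaxU.le⟩)
  refine (N.integrable_fadingUser.const_mul (p.G * p.Ptx * B / p.noise / Real.log 2)).mono'
    N.measurable_secrecyRate.aestronglyMeasurable ?_
  filter_upwards [N.ae_fading_pos, N.ae_distUser_mem] with ω hH hd
  rw [Real.norm_of_nonneg (N.secrecyRate_nonneg ω), secrecyRate]
  have hH1 := hH.1
  have hH2 := hH.2
  have hpos : 0 ≤ p.G * p.Ptx * B / p.noise / Real.log 2 * N.fadingUser ω := by positivity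
  split_ifs with hs
  swap
  · exact hpos
  refine max_le ?_ hpos
  have hE : 0 ≤ N.rateEve ω := by
    rw [rateEve]
    split_ifs
    · have : 0 ≤ N.distEve ω := dist_nonneg
      apply Real.logb_nonneg one_lt_two
      have : 0 ≤ p.Ge * p.Ptx * N.fadingEve ω * N.distEve ω ^ (-p.α) / p.noise := by positivity
      linarith
    · exact le_rfl
  have hd0 : 0 ≤ N.distUser ω := dist_nonneg
  have hdB : N.distUser ω ^ (-p.α) ≤ B := (le_abs_self _).trans (hB _ (hd hs))
  have hx : 0 ≤ p.G * p.Ptx * N.fadingUser ω * N.distUser ω ^ (-p.α) / p.noise := by positivity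
  have hU : N.rateUser ω ≤ p.G * p.Ptx * N.fadingUser ω * N.distUser ω ^ (-p.α) / p.noise /
      Real.log 2 := by
    rw [rateUser, Real.logb]
    gcongr
    have := Real.log_le_sub_one_of_pos
      (x := 1 + p.G * p.Ptx * N.fadingUser ω * N.distUser ω ^ (-p.α) / p.noise) (by linarith)
    linarith
  calc N.rateUser ω - N.rateEve ω ≤ N.rateUser ω := by linarith
    _ ≤ p.G * p.Ptx * N.fadingUser ω * N.distUser ω ^ (-p.α) / p.noise / Real.log 2 := hU
    _ ≤ p.G * p.Ptx * N.fadingUser ω * B / p.noise / Real.log 2 := by gcongr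
    _ = _ := by ring

lemma integrableOn_ccdf (N : Network p μ) : IntegrableOn p.ccdf (Set.Ioi 0) := by
  have hm : Measurable fun t : ℝ => μ {ω | t ≤ N.secrecyRate ω} :=
    Antitone.measurable fun s t hst => measure_mono fun ω h => hst.trans h
  have hfin : ∫⁻ t in Set.Ioi (0 : ℝ), μ {ω | t ≤ N.secrecyRate ω} ≠ ⊤ := by
    rw [← lintegral_eq_lintegral_meas_le μ (.of_forall N.secrecyRate_nonneg)
      N.measurable_secrecyRate.aemeasurable]
    have := N.integrable_secrecyRate.lintegral_lt_top
    exact this.ne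
  refine (integrable_toReal_of_lintegral_ne_top hm.aemeasurable hfin).congr ?_
  refine (ae_restrict_iff' measurableSet_Ioi).2 (.of_forall fun t ht => ?_)
  rw [← N.measureReal_exceeds (le_of_lt ht), ← N.setOf_le_secrecyRate ht, measureReal_def]

lemma ergodicSecrecyRate_eq : N.ergodicSecrecyRate = ∫ γ in Set.Ioi (0 : ℝ), p.ccdf γ := by
  rw [ergodicSecrecyRate, N.integrable_secrecyRate.integral_eq_integral_meas_le
    (.of_forall N.secrecyRate_nonneg)]
  refine setIntegral_congr_fun measurableSet_Ioi fun t ht => ?_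
  rw [← N.measureReal_exceeds (le_of_lt ht), ← N.setOf_le_secrecyRate ht]

end Network

end SatSecrecy

end

theorem theorem1 {Ω : Type*} [MeasurableSpace Ω] (μ : Measure Ω) [IsProbabilityMeasure μ]
    (p : SatSecrecy.Params) (N : SatSecrecy.Network p μ) :
    -- the weights of the two cases
    μ.real N.servedNoEve = (1 - p.voidU) * p.voidE ∧
    μ.real N.servedEve = (1 - p.voidU) * (1 - p.voidE) ∧
    -- the conditional distributions of the two nearest distances
    (ProbabilityTheory.cond μ N.served).map N.distUser =
      (volume.restrict (Set.Icc p.Rmin p.RmaxU)).withDensity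
        (fun r => ENNReal.ofReal (p.densU r)) ∧
    (ProbabilityTheory.cond μ N.servedEve).map N.distEve =
      (volume.restrict (Set.Icc p.Rmin p.RmaxE)).withDensity
        (fun r => ENNReal.ofReal (p.densE r)) ∧
    -- the Laplace transform of the power of signal plus noise at the nearest eavesdropper
    (∀ γ r s : ℝ, 0 ≤ γ → 0 < r → 0 ≤ s →
      ∫ ω, Real.exp (-(s * ((2 : ℝ) ^ γ * (p.sbar + p.Gbar * N.fadingEve ω * r ^ (-p.α)) - p.sbar)))
        ∂(ProbabilityTheory.cond μ N.servedEve) = p.laplace γ r s) ∧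
    -- the CCDF in the two cases, and the total CCDF
    (∀ γ : ℝ, 0 ≤ γ →
      (ProbabilityTheory.cond μ N.servedNoEve).real (N.exceeds γ) = p.ccdfNoEve γ ∧
      (ProbabilityTheory.cond μ N.servedEve).real (N.exceeds γ) = p.ccdfEve γ ∧
      μ.real (N.exceeds γ) = p.ccdf γ) ∧
    -- the ergodic secrecy rate
    Integrable N.secrecyRate μ ∧
    IntegrableOn p.ccdf (Set.Ioi 0) ∧
    N.ergodicSecrecyRate = ∫ γ in Set.Ioi (0 : ℝ), p.ccdf γ := by

  refine ⟨N.measureReal_servedNoEve, N.measureReal_servedEve, N.cond_map_served.2,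
    N.cond_map_distEve, fun γ r s _ hr hs => ?_, fun γ hγ => ⟨N.cond_real_exceeds_noEve hγ,
      N.cond_real_exceeds_eve hγ, N.measureReal_exceeds hγ⟩, N.integrable_secrecyRate,
    N.integrableOn_ccdf, N.ergodicSecrecyRate_eq⟩
  rw [← p.integral_exp_neg_eveThreshold hr hs, ← N.cond_map_fadingEve,
    integral_map N.measurable_fadingEve.aemeasurable]
  · rfl
  · have := p.continuous_eveThreshold γ r
    exact Continuous.aestronglyMeasurable (by fun_prop)
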